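/- Let $\mathbb T^2=(\mathbb R/2\pi\mathbb Z)^2$ with normalised integral and $\hat f(n)=\int_{\mathbb T^2}f(x)e^{in\cdot x}\,dx$. Fix a family of Littlewood--Paley projectors: $\widehat{P_Nf}(n)=\phi(n/N)\hat f(n)$ for $N\in\{1,2,4,\dots\}$, where $\phi:\mathbb R^2\to\mathbb R$ is smooth, vanishes outside $\{\frac12<|\xi|<2\}$, and satisfies $\sum_{N}\phi(\xi/N)=1$ for $|\xi|\ge1$. For $\beta\in\mathbb R$ set $\|f\|_{\mathcal C^\beta}=\sup_N N^\beta\|P_Nf\|_{L^\infty}$, and let $\mathcal C^\beta$ be the closure of the smooth, divergence-free and mean-free vector fields $\mathbb T^2\to\mathbb R^2$ under this norm, inside the mean-free distributions of finite norm. Let $P$ be the Leray projector, let $|\nabla|^s$ be the Fourier multiplier with symbol $|n|^s$, write $(\operatorname{div}(u\otimes v))_j=\sum_i\partial_i(u_iv_j)$, and set $$G_\alpha(u)=|\nabla|^{-\alpha}P\operatorname{div}\bigl(u\otimes|\nabla|^\alpha u\bigr)-P\operatorname{div}(u\otimes u).$$ Let $\alpha>0$, $\beta>\alpha/2$ and $\kappa>0$.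 Then there is a constant $C$, depending only on $\alpha,\beta,\kappa$ and $\phi$, such that for every divergence-free and mean-free $\mathbb R^2$-valued distribution $u$ on $\mathbb T^2$ with $\|u\|_{\mathcal C^\beta}<\infty$ the products $u\otimes u$ and $u\otimes|\nabla|^\alpha u$ are well defined (the convolution sums giving their Fourier coefficients converge absolutely) and $$\|G_\alpha(u)\|_{\mathcal C^{\min\{\beta,2\beta-1\}-\kappa}}\le C\,\|u\|_{\mathcal C^\beta}^2 .$$ In particular, $G_\alpha$ maps $\mathcal C^\beta$ to $\mathcal C^{\min\{\beta,2\beta-1\}-\kappa}$, and this map is uniformly smooth: it is infinitely Fréchet differentiable, and it and all its derivatives are bounded on bounded sets. -/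

import Mathlib

open scoped ContDiff ENNReal NNReal

noncomputable section

namespace GalNS

/-! ### Frequencies and periodic distributions -/

/-- Frequencies `n ∈ ℤ²`, dual to the torus `𝕋² = (ℝ/2πℤ)²`. -/
abbrev Freq := Fin 2 → ℤ

/-- A frequency seen as a vector of the Euclidean plane; `|n|` is `‖Freq.vec n‖`. -/
def Freq.vec (n : Freq) : EuclideanSpace ℝ (Fin 2) := WithLp.toLp 2 fun i => (n i : ℝ)

/-- The phase `n · x`. -/
def phase (n : Freq) (x : Fin 2 → ℝ) : ℝ := ∑ i, (n i : ℝ) * x i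

/-- A (vector-valued) periodic distribution `f` on `𝕋²`, identified with its Fourier coefficients
`n ↦ f̂(n) = ∫ f(x) e^{i n·x} dx` (normalised integral), so that `f(x) = ∑ₙ f̂(n) e^{-i n·x}`.
No growth condition is built in: finiteness of a Hölder-Besov norm, which is assumed or
proved wherever a distribution is used, forces polynomial growth of the coefficients. -/
abbrev VField := Freq → EuclideanSpace ℂ (Fin 2)

/-- A matrix-valued periodic distribution, again through its Fourier coefficients. -/
abbrev TField := Freq → Matrix (Fin 2) (Fin 2) ℂ

/-- `u` is `ℝ²`-valued, mean-free and divergence-free. -/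
structure IsSolenoidal (u : VField) : Prop where
  real : ∀ n i, u (-n) i = (starRingEnd ℂ) (u n i)
  meanFree : u 0 = 0
  divFree : ∀ n, ∑ i, (n i : ℂ) * u n i = 0

/-! ### The operators -/

/-- The Fourier multiplier `|∇|^s` (for `s ≠ 0` it annihilates the mean). -/
def fracGrad (s : ℝ) (u : VField) : VField := fun n => ((‖n.vec‖ ^ s : ℝ) : ℂ) • u n

/-- The Leray projector; it acts as the identity on constants. -/
def leray (u : VField) : VField := fun n => WithLp.toLp 2 fun j =>
  u n j - (∑ i, (n i : ℂ) * u n i) / ((‖n.vec‖ ^ 2 : ℝ) : ℂ) * (n j : ℂ)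

/-- The product `u ⊗ v`, with entries `uᵢ vⱼ`: the convolution of the Fourier coefficients. -/
def tensor (u v : VField) : TField := fun n => Matrix.of fun i j => ∑' k : Freq, u k i * v (n - k) j

/-- The Fourier series defining `u ⊗ v` converge absolutely. -/
def TensorDefined (u v : VField) : Prop :=
  ∀ (n : Freq) (i j : Fin 2), Summable fun k : Freq => u k i * v (n - k) j

/-- `(div T)ⱼ = ∑ᵢ ∂ᵢ Tᵢⱼ`, so that `div (u ⊗ v) = (u · ∇) v` for divergence-free `u`;
with the above sign convention `∂ᵢ` has the symbol `-i nᵢ`. -/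
def tdiv (T : TField) : VField := fun n => WithLp.toLp 2 fun j =>
  ∑ i, (-(Complex.I * (n i : ℂ))) * T n i j

/-- `G_α(u) = |∇|^{-α} P div (u ⊗ |∇|^α u) - P div (u ⊗ u)`. -/
def galG (α : ℝ) (u : VField) : VField :=
  fracGrad (-α) (leray (tdiv (tensor u (fracGrad α u)))) - leray (tdiv (tensor u u))

/-! ### Smooth vector fields -/

/-- Smooth, divergence-free, mean-free vector fields on `𝕋²`, as `2π`-periodic fields on the
plane. -/
structure IsSmoothSolenoidal (U : (Fin 2 → ℝ) → (Fin 2 → ℝ)) : Prop where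
  smooth : ContDiff ℝ ∞ U
  periodic : ∀ x i, U (x + Pi.single i (2 * Real.pi)) = U x
  divFree : ∀ x, ∑ i, fderiv ℝ U x (Pi.single i 1) i = 0
  meanFree : ∀ i, ∫ x in Set.Icc (0 : Fin 2 → ℝ) (fun _ => 2 * Real.pi), U x i = 0

/-- Fourier coefficients `∫ U(x) e^{i n·x} dx` with respect to the normalised integral. -/
def coeff (U : (Fin 2 → ℝ) → (Fin 2 → ℝ)) : VField := fun n => WithLp.toLp 2 fun i =>
  (((2 * Real.pi) ^ 2 : ℝ) : ℂ)⁻¹ *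
    ∫ x in Set.Icc (0 : Fin 2 → ℝ) (fun _ => 2 * Real.pi),
      Complex.exp (Complex.I * (phase n x : ℂ)) * (U x i : ℂ)

/-! ### Littlewood-Paley projectors and the Hölder-Besov norm -/

/-- The symbol generating a family of Littlewood-Paley projectors `P_N`, where `N = 2^j` runs over
the dyadic integers. -/
structure LittlewoodPaley where
  symb : EuclideanSpace ℝ (Fin 2) → ℝ
  smooth : ContDiff ℝ ∞ symb
  supp : ∀ ξ, symb ξ ≠ 0 → 1 / 2 < ‖ξ‖ ∧ ‖ξ‖ < 2
  sum_one : ∀ ξ, 1 ≤ ‖ξ‖ → HasSum (fun j : ℕ => symb (((2 : ℝ) ^ j)⁻¹ • ξ)) 1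

namespace LittlewoodPaley

variable (φ : LittlewoodPaley)

/-- `P_N f` for `N = 2^j`, evaluated at `x` (only finitely many terms are nonzero). -/
def block (j : ℕ) (f : VField) (x : Fin 2 → ℝ) : EuclideanSpace ℂ (Fin 2) :=
  ∑' n : Freq, ((φ.symb (((2 : ℝ) ^ j)⁻¹ • n.vec) : ℂ) *
    Complex.exp (-(Complex.I * (phase n x : ℂ)))) • f n

/-- `‖f‖_{𝒞^β} = sup_N N^β ‖P_N f‖_{L^∞}`, possibly infinite. -/
def besovENorm (β : ℝ) (f : VField) : ℝ≥0∞ :=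
  ⨆ (j : ℕ) (x : Fin 2 → ℝ), ENNReal.ofReal (((2 : ℝ) ^ j) ^ β * ‖φ.block j f x‖)

end LittlewoodPaley

/-! #### Facts needed to make the Hölder-Besov spaces normed spaces -/

theorem Freq.abs_le_norm_vec (n : Freq) (i : Fin 2) : |(n i : ℝ)| ≤ ‖n.vec‖ := by
  have := PiLp.norm_apply_le (p := 2) n.vec i
  simpa [Freq.vec] using this

theorem Freq.one_le_norm_vec {n : Freq} (hn : n ≠ 0) : 1 ≤ ‖n.vec‖ := by
  obtain ⟨i, hi⟩ := Function.ne_iff.1 hn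
  refine le_trans ?_ (Freq.abs_le_norm_vec n i)
  exact_mod_cast Int.one_le_abs hi

theorem Freq.finite_norm_lt (R : ℝ) : {n : Freq | ‖n.vec‖ < R}.Finite := by
  refine (Set.finite_Icc (fun _ => -⌈R⌉ : Freq) (fun _ => ⌈R⌉)).subset fun n hn => ?_
  have h : ∀ i, |(n i : ℝ)| ≤ (⌈R⌉ : ℝ) := fun i =>
    (Freq.abs_le_norm_vec n i).trans ((le_of_lt hn).trans (Int.le_ceil R))
  refine ⟨fun i => ?_, fun i => ?_⟩
  · have := (abs_le.1 (h i)).1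
    exact_mod_cast this
  · have := (abs_le.1 (h i)).2
    exact_mod_cast this

namespace LittlewoodPaley

variable (φ : LittlewoodPaley)

theorem finite_symb (j : ℕ) :
    {n : Freq | φ.symb (((2 : ℝ) ^ j)⁻¹ • n.vec) ≠ 0}.Finite := by
  refine (Freq.finite_norm_lt (2 ^ j * 2)).subset fun n hn => ?_
  have h := (φ.supp _ hn).2
  rw [norm_smul, norm_inv, norm_pow, Real.norm_ofNat, inv_mul_lt_iff₀ (by positivity)] at h
  exact h

theorem block_eq_sum (j : ℕ) (f : VField) (x : Fin 2 → ℝ) :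
    φ.block j f x = ∑ n ∈ (φ.finite_symb j).toFinset, ((φ.symb (((2 : ℝ) ^ j)⁻¹ • n.vec) : ℂ) *
      Complex.exp (-(Complex.I * (phase n x : ℂ)))) • f n := by
  refine tsum_eq_sum fun n hn => ?_
  have : φ.symb (((2 : ℝ) ^ j)⁻¹ • n.vec) = 0 := by simpa using hn
  simp [this]

theorem block_add (j : ℕ) (f g : VField) (x : Fin 2 → ℝ) :
    φ.block j (f + g) x = φ.block j f x + φ.block j g x := by
  simp only [block_eq_sum, Pi.add_apply, smul_add, Finset.sum_add_distrib]

theorem block_smul (j : ℕ) (c : ℝ) (f : VField) (x : Fin 2 → ℝ) :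
    φ.block j (c • f) x = c • φ.block j f x := by
  simp only [block_eq_sum, Pi.smul_apply, Finset.smul_sum]
  exact Finset.sum_congr rfl fun n _ => smul_comm _ _ _

theorem besovENorm_add_le (β : ℝ) (f g : VField) :
    φ.besovENorm β (f + g) ≤ φ.besovENorm β f + φ.besovENorm β g := by
  refine iSup₂_le fun j x => ?_
  calc ENNReal.ofReal (((2 : ℝ) ^ j) ^ β * ‖φ.block j (f + g) x‖)
      ≤ ENNReal.ofReal (((2 : ℝ) ^ j) ^ β * ‖φ.block j f x‖
          + ((2 : ℝ) ^ j) ^ β * ‖φ.block j g x‖) := by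
        rw [block_add, ← mul_add]
        exact ENNReal.ofReal_le_ofReal
          (mul_le_mul_of_nonneg_left (norm_add_le _ _) (by positivity))
    _ ≤ _ := ENNReal.ofReal_add_le
    _ ≤ _ := add_le_add
        (le_iSup₂ (f := fun (j : ℕ) (x : Fin 2 → ℝ) =>
          ENNReal.ofReal (((2 : ℝ) ^ j) ^ β * ‖φ.block j f x‖)) j x)
        (le_iSup₂ (f := fun (j : ℕ) (x : Fin 2 → ℝ) =>
          ENNReal.ofReal (((2 : ℝ) ^ j) ^ β * ‖φ.block j g x‖)) j x)

theorem besovENorm_smul (β c : ℝ) (f : VField) :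
    φ.besovENorm β (c • f) = ENNReal.ofReal |c| * φ.besovENorm β f := by
  simp only [besovENorm, ENNReal.mul_iSup]
  refine iSup_congr fun j => iSup_congr fun x => ?_
  rw [block_smul, norm_smul, Real.norm_eq_abs, ← ENNReal.ofReal_mul (abs_nonneg c)]
  congr 1
  ring

theorem besovENorm_zero (β : ℝ) : φ.besovENorm β 0 = 0 := by
  simpa using φ.besovENorm_smul β 0 0

/-- The character `x ↦ e^{-i n·x}` of the plane. -/
def character (n : Freq) : Multiplicative (Fin 2 → ℝ) →* ℂ where
  toFun x := Complex.exp (-(Complex.I * (phase n x.toAdd : ℂ)))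
  map_one' := by simp [phase]
  map_mul' x y := by
    rw [← Complex.exp_add]
    congr 1
    simp only [phase, toAdd_mul, Pi.add_apply, mul_add, Finset.sum_add_distrib]
    push_cast
    ring

theorem character_injective : Function.Injective character := by
  intro n m h
  funext i
  have key : ∀ t : ℝ, Complex.exp (-(Complex.I * ((n i : ℝ) * t : ℝ)))
      = Complex.exp (-(Complex.I * ((m i : ℝ) * t : ℝ))) := by
    intro t
    have := DFunLike.congr_fun h (Multiplicative.ofAdd (Pi.single i t))
    simpa only [character, phase, MonoidHom.coe_mk, OneHom.coe_mk, toAdd_ofAdd, Pi.single_apply,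
      mul_ite, mul_zero, Finset.sum_ite_eq', Finset.mem_univ, if_true] using this
  by_contra hne
  have hd : ((n i : ℝ) - m i) ≠ 0 := by
    intro h0
    exact hne (by exact_mod_cast sub_eq_zero.1 h0)
  have h1 := key (Real.pi / ((n i : ℝ) - m i))
  have h2 : Complex.exp (-(Complex.I * ((n i : ℝ) * (Real.pi / ((n i : ℝ) - m i)) : ℝ)))
      = Complex.exp (-(Complex.I * ((m i : ℝ) * (Real.pi / ((n i : ℝ) - m i)) : ℝ)))
        * Complex.exp (-(Real.pi * Complex.I)) := by
    rw [← Complex.exp_add]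
    congr 1
    have : (n i : ℝ) * (Real.pi / ((n i : ℝ) - m i))
        = (m i : ℝ) * (Real.pi / ((n i : ℝ) - m i)) + Real.pi := by
      field_simp
      ring
    rw [this]
    push_cast
    ring
  rw [h1, Complex.exp_neg (Real.pi * Complex.I), Complex.exp_pi_mul_I] at h2
  have h3 := Complex.exp_ne_zero (-(Complex.I * ((m i : ℝ) * (Real.pi / ((n i : ℝ) - m i)) : ℝ)))
  apply h3
  linear_combination (1 / 2 : ℂ) * h2

theorem eq_zero_of_block_eq_zero (f : VField) (h0 : f 0 = 0)
    (h : ∀ j x, φ.block j f x = 0) : f = 0 := by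
  have hli : LinearIndependent ℂ fun n : Freq => (character n : Multiplicative (Fin 2 → ℝ) → ℂ) :=
    (linearIndependent_monoidHom (Multiplicative (Fin 2 → ℝ)) ℂ).comp character character_injective
  have hz : ∀ (j : ℕ) (n : Freq) (i : Fin 2),
      (φ.symb (((2 : ℝ) ^ j)⁻¹ • n.vec) : ℂ) * f n i = 0 := by
    intro j n i
    by_cases hn : φ.symb (((2 : ℝ) ^ j)⁻¹ • n.vec) = 0
    · simp [hn]
    refine linearIndependent_iff'.1 hli (φ.finite_symb j).toFinset
      (fun n => (φ.symb (((2 : ℝ) ^ j)⁻¹ • n.vec) : ℂ) * f n i) ?_ n (by simpa using hn)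
    funext x
    have hx := congrArg (fun v : EuclideanSpace ℂ (Fin 2) => v i) (h j x.toAdd)
    simp only [block_eq_sum, WithLp.ofLp_sum, Finset.sum_apply, PiLp.smul_apply, PiLp.zero_apply,
      smul_eq_mul] at hx
    simp only [Finset.sum_apply, Pi.smul_apply, smul_eq_mul, Pi.zero_apply]
    rw [← hx]
    refine Finset.sum_congr rfl fun m _ => ?_
    simp only [character, MonoidHom.coe_mk, OneHom.coe_mk]
    ring
  funext n
  by_cases hn : n = 0
  · simpa [hn] using h0
  have hs := φ.sum_one n.vec (Freq.one_le_norm_vec hn)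
  obtain ⟨j, hj⟩ : ∃ j : ℕ, φ.symb (((2 : ℝ) ^ j)⁻¹ • n.vec) ≠ 0 := by
    by_contra! hc
    simp only [hc] at hs
    exact zero_ne_one (hasSum_zero.unique hs)
  ext i
  have := hz j n i
  simpa [hj] using this

theorem eq_zero_of_besovENorm_eq_zero {β : ℝ} {f : VField} (h0 : f 0 = 0)
    (h : φ.besovENorm β f = 0) : f = 0 := by
  refine φ.eq_zero_of_block_eq_zero f h0 fun j x => ?_
  simp only [besovENorm, ENNReal.iSup_eq_zero, ENNReal.ofReal_eq_zero] at h
  have hp : (0 : ℝ) < ((2 : ℝ) ^ j) ^ β := by positivity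
  have := h j x
  exact norm_le_zero_iff.1 (nonpos_of_mul_nonpos_right this hp)

end LittlewoodPaley

theorem integrableOn_coeff {U : (Fin 2 → ℝ) → (Fin 2 → ℝ)} (hU : IsSmoothSolenoidal U)
    (n : Freq) (i : Fin 2) :
    MeasureTheory.IntegrableOn
      (fun x => Complex.exp (Complex.I * (phase n x : ℂ)) * (U x i : ℂ))
      (Set.Icc (0 : Fin 2 → ℝ) (fun _ => 2 * Real.pi)) := by
  have := hU.smooth.continuous
  refine Continuous.integrableOn_Icc ?_
  unfold phase
  fun_prop

theorem integrableOn_comp {U : (Fin 2 → ℝ) → (Fin 2 → ℝ)} (hU : IsSmoothSolenoidal U)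
    (i : Fin 2) :
    MeasureTheory.IntegrableOn (fun x => U x i)
      (Set.Icc (0 : Fin 2 → ℝ) (fun _ => 2 * Real.pi)) := by
  have := hU.smooth.continuous
  exact Continuous.integrableOn_Icc (by fun_prop)

theorem IsSmoothSolenoidal.zero : IsSmoothSolenoidal 0 where
  smooth := contDiff_const
  periodic _ _ := rfl
  divFree x := by
    have : fderiv ℝ (0 : (Fin 2 → ℝ) → (Fin 2 → ℝ)) x = 0 := by simp
    simp [this]
  meanFree i := by simp

theorem IsSmoothSolenoidal.add {U V : (Fin 2 → ℝ) → (Fin 2 → ℝ)} (hU : IsSmoothSolenoidal U)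
    (hV : IsSmoothSolenoidal V) : IsSmoothSolenoidal (U + V) where
  smooth := hU.smooth.add hV.smooth
  periodic x i := by simp [hU.periodic, hV.periodic]
  divFree x := by
    rw [fderiv_add (hU.smooth.differentiable (by simp) x) (hV.smooth.differentiable (by simp) x)]
    simp only [add_apply, Pi.add_apply, Finset.sum_add_distrib, hU.divFree,
      hV.divFree, add_zero]
  meanFree i := by
    simp only [Pi.add_apply]
    rw [MeasureTheory.integral_add (integrableOn_comp hU i) (integrableOn_comp hV i),
      hU.meanFree, hV.meanFree, add_zero]

theorem IsSmoothSolenoidal.smul {U : (Fin 2 → ℝ) → (Fin 2 → ℝ)} (c : ℝ)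
    (hU : IsSmoothSolenoidal U) : IsSmoothSolenoidal (c • U) where
  smooth := hU.smooth.const_smul c
  periodic x i := by simp [hU.periodic]
  divFree x := by
    rw [fderiv_const_smul (hU.smooth.differentiable (by simp) x)]
    simp only [smul_apply, Pi.smul_apply, ← Finset.smul_sum, hU.divFree,
      smul_zero]
  meanFree i := by
    simp only [Pi.smul_apply, smul_eq_mul]
    rw [MeasureTheory.integral_const_mul, hU.meanFree, mul_zero]

theorem coeff_zero : coeff 0 = 0 := by
  funext n
  ext i
  simp [coeff]

theorem coeff_add {U V : (Fin 2 → ℝ) → (Fin 2 → ℝ)} (hU : IsSmoothSolenoidal U)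
    (hV : IsSmoothSolenoidal V) : coeff (U + V) = coeff U + coeff V := by
  funext n
  ext i
  simp only [coeff, Pi.add_apply, PiLp.add_apply, Complex.ofReal_add]
  rw [← mul_add, ← MeasureTheory.integral_add (integrableOn_coeff hU n i)
    (integrableOn_coeff hV n i)]
  simp only [mul_add]

theorem coeff_smul (c : ℝ) (U : (Fin 2 → ℝ) → (Fin 2 → ℝ)) : coeff (c • U) = c • coeff U := by
  funext n
  ext i
  simp only [coeff, Pi.smul_apply, PiLp.smul_apply, smul_eq_mul, Complex.ofReal_mul,
    Complex.real_smul]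
  rw [mul_left_comm (c : ℂ), ← MeasureTheory.integral_const_mul (c : ℂ)]
  simp only [mul_left_comm]

/-! ### The Hölder-Besov spaces -/

namespace LittlewoodPaley

variable (φ : LittlewoodPaley)

/-- The closure of the smooth, divergence-free, mean-free vector fields for `‖·‖_{𝒞^β}`, inside
the mean-free distributions of finite norm. (The norm does not see the mean.) -/
def holderBesovSubmodule (β : ℝ) : Submodule ℝ VField where
  carrier := {u | u 0 = 0 ∧ φ.besovENorm β u < ⊤ ∧
    ∀ ε : ℝ, 0 < ε → ∃ U, IsSmoothSolenoidal U ∧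
      φ.besovENorm β (u - coeff U) ≤ ENNReal.ofReal ε}
  zero_mem' := by
    refine ⟨rfl, by simp [besovENorm_zero], fun ε _ => ⟨0, .zero, ?_⟩⟩
    simp [coeff_zero, besovENorm_zero]
  add_mem' := by
    rintro u v ⟨hu0, hu, hu'⟩ ⟨hv0, hv, hv'⟩
    refine ⟨by simp [hu0, hv0],
      (φ.besovENorm_add_le β u v).trans_lt (ENNReal.add_lt_top.2 ⟨hu, hv⟩), fun ε hε => ?_⟩
    obtain ⟨U, hU, hU'⟩ := hu' (ε / 2) (by positivity)
    obtain ⟨V, hV, hV'⟩ := hv' (ε / 2) (by positivity)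
    refine ⟨U + V, hU.add hV, ?_⟩
    rw [coeff_add hU hV, add_sub_add_comm]
    refine (φ.besovENorm_add_le β _ _).trans ((add_le_add hU' hV').trans ?_)
    rw [← ENNReal.ofReal_add (by positivity) (by positivity), add_halves]
  smul_mem' := by
    rintro c u ⟨hu0, hu, hu'⟩
    refine ⟨by simp [hu0], ?_, fun ε hε => ?_⟩
    · rw [besovENorm_smul]
      exact ENNReal.mul_lt_top ENNReal.ofReal_lt_top hu
    obtain ⟨U, hU, hU'⟩ := hu' (ε / (|c| + 1)) (by positivity)
    refine ⟨c • U, hU.smul c, ?_⟩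
    rw [coeff_smul, ← smul_sub, besovENorm_smul]
    refine (mul_le_mul_right hU' _).trans ?_
    rw [← ENNReal.ofReal_mul (abs_nonneg c)]
    refine ENNReal.ofReal_le_ofReal ?_
    rw [← mul_div_assoc, div_le_iff₀ (by positivity)]
    nlinarith [abs_nonneg c]

/-- The space `𝒞^β`. -/
def HolderBesov (β : ℝ) : Type := ↥(φ.holderBesovSubmodule β)

namespace HolderBesov

variable {φ} {β : ℝ}

/-- The underlying distribution. -/
def toField (u : φ.HolderBesov β) : VField := u.1

instance : AddCommGroup (φ.HolderBesov β) :=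
  inferInstanceAs (AddCommGroup ↥(φ.holderBesovSubmodule β))

instance : Module ℝ (φ.HolderBesov β) :=
  inferInstanceAs (Module ℝ ↥(φ.holderBesovSubmodule β))

instance : Norm (φ.HolderBesov β) := ⟨fun u => (φ.besovENorm β u.toField).toReal⟩

theorem norm_def (u : φ.HolderBesov β) : ‖u‖ = (φ.besovENorm β u.toField).toReal := rfl

theorem besovENorm_ne_top (u : φ.HolderBesov β) : φ.besovENorm β u.toField ≠ ⊤ := u.2.2.1.ne

theorem core : NormedSpace.Core ℝ (φ.HolderBesov β) where
  norm_nonneg u := ENNReal.toReal_nonneg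
  norm_smul c u := by
    have : φ.besovENorm β (c • u).toField = ENNReal.ofReal |c| * φ.besovENorm β u.toField :=
      φ.besovENorm_smul β c u.toField
    rw [norm_def, norm_def, this, ENNReal.toReal_mul, ENNReal.toReal_ofReal (abs_nonneg c),
      Real.norm_eq_abs]
  norm_triangle u v := by
    rw [norm_def, norm_def, norm_def, ← ENNReal.toReal_add u.besovENorm_ne_top v.besovENorm_ne_top]
    exact ENNReal.toReal_mono (ENNReal.add_ne_top.2 ⟨u.besovENorm_ne_top, v.besovENorm_ne_top⟩)
      (φ.besovENorm_add_le β u.toField v.toField)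
  norm_eq_zero_iff u := by
    rw [norm_def, ENNReal.toReal_eq_zero_iff, or_iff_left u.besovENorm_ne_top]
    refine ⟨fun h => Subtype.ext (φ.eq_zero_of_besovENorm_eq_zero u.2.1 h), fun h => ?_⟩
    subst h
    exact φ.besovENorm_zero β

instance : NormedAddCommGroup (φ.HolderBesov β) := NormedAddCommGroup.ofCore core

instance : NormedSpace ℝ (φ.HolderBesov β) := NormedSpace.ofCore core

end HolderBesov

end LittlewoodPaley

/-! ### Uniform smoothness -/

/-- Infinitely Fréchet differentiable, with all derivatives (including the zeroth) bounded on
bounded sets. -/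
def UniformlySmooth {X Y : Type*} [NormedAddCommGroup X] [NormedSpace ℝ X]
    [NormedAddCommGroup Y] [NormedSpace ℝ Y] (F : X → Y) : Prop :=
  ContDiff ℝ ∞ F ∧
    ∀ (k : ℕ) (R : ℝ), ∃ C : ℝ, ∀ x : X, ‖x‖ ≤ R → ‖iteratedFDeriv ℝ k F x‖ ≤ C

end GalNS

end

noncomputable section

namespace GalNS

/-! ### Fourier multipliers on trigonometric sums -/

/-! `galG α u` is the diagonal of the bilinear form `galB α u v`. With k the frequency of u and m
that of v, `galB_apply` shows that this form has the symbol `galSymb`: the Leray symbol at k + m,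
times one derivative -i(k + m)_i, times |m|^α |k + m|^(-α) - 1. Cut u and v into blocks at the
scales 2^a and 2^b, and look at the output at scale 2^j. By `localisation` three regimes survive.

Low-high (a + 4 ≤ b, so b ≈ j): the last factor of the symbol vanishes at k = 0, a commutator
cancellation worth 2^(a-b) (`exists_commutator_bound`). The output has size 2^(a(1-β) - jβ). For β ≤
1 the worst case is a = j, giving 2^(-j(2β-1)); for β ≥ 1 it is a = 0, giving 2^(-jβ). This is where
min{β, 2β-1} comes from.

High-low (b + 4 ≤ a, so a ≈ j): since k · û(k) = 0, the derivative k + m may be replaced by m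
(`sum_pair_galSymb`). It then costs 2^b in place of 2^j, and the same exponents result.

High-high (|a - b| ≤ 3, j at most b + 5): no cancellation is needed. The two halves of the symbol
give 2^(j(1-α)) 2^(b(α-2β)) and 2^j 2^(-2bβ), which decay in b because β > α/2.

The loss κ pays for geometric weights 2^(-ε|a-j| - ε|b-j|), so the sum over a and b converges
uniformly in the truncation (`exists_truncated_bound`). All multiplier bounds come from writing a
smooth compactly supported symbol as the Fourier transform of an integrable kernel, so that the
multiplier averages translates.

To remove the truncation, Bessel's inequality on each block embeds 𝒞^β in the Sobolev space H^s for
0 ≤ s < β. Putting α/2 derivatives on each factor, Cauchy-Schwarz makes the convolution sums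
converge absolutely, even with the weight |m|^α (`summable_convolution`); dominated convergence
finishes (`tendsto_sum_pair`).

The map must land in a closure of smooth fields. The estimate with κ/2 in place of κ leaves room to
approximate by frequency truncation (`mem_holderBesovSubmodule`); conversely, elements of the
closure are solenoidal because Fourier coefficients are continuous functionals. Hence `galB` is a
continuous bilinear map between these spaces, and its diagonal is uniformly smooth. -/

/-- A smooth compactly supported symbol is the Fourier transform of a kernel with finite first
moment. -/
theorem exists_kernel {E : Type*} [NormedAddCommGroup E] [InnerProductSpace ℝ E]
    [FiniteDimensional ℝ E] [MeasurableSpace E] [BorelSpace E] (ψ : E → ℂ)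
    (hψ : ContDiff ℝ ∞ ψ) (hc : HasCompactSupport ψ) :
    ∃ K : E → ℂ, MeasureTheory.Integrable K ∧ MeasureTheory.Integrable (fun y => ‖y‖ * ‖K y‖) ∧
      ∀ ξ, ψ ξ = ∫ y, Complex.exp (((2 * Real.pi * inner ℝ y ξ : ℝ) : ℂ) * Complex.I) * K y := by
  let f : SchwartzMap E ℂ := hc.toSchwartzMap hψ
  refine ⟨(FourierTransform.fourier f : SchwartzMap E ℂ), SchwartzMap.integrable _, ?_, fun ξ => ?_⟩
  · simpa using SchwartzMap.integrable_pow_mul MeasureTheory.volume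
      (FourierTransform.fourier f : SchwartzMap E ℂ) 1
  · have h : ψ ξ = (FourierTransformInv.fourierInv
        (FourierTransform.fourier f : SchwartzMap E ℂ) : SchwartzMap E ℂ) ξ := by
      rw [FourierTransform.fourierInv_fourier_eq]
      rfl
    rw [h, SchwartzMap.fourierInv_coe, Real.fourierInv_eq']
    simp only [smul_eq_mul]

/-- The wave `e^{-i n·x}`. -/
def wave (n : Freq) (x : Fin 2 → ℝ) : ℂ := Complex.exp (-(Complex.I * (phase n x : ℂ)))

theorem wave_add (n m : Freq) (x : Fin 2 → ℝ) : wave (n + m) x = wave n x * wave m x := by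
  rw [wave, wave, wave, ← Complex.exp_add]
  congr 1
  simp only [phase, Pi.add_apply, Int.cast_add, add_mul, Finset.sum_add_distrib]
  push_cast
  ring

theorem wave_sub (n : Freq) (x h : Fin 2 → ℝ) :
    wave n (x - h) = Complex.exp (Complex.I * (phase n h : ℂ)) * wave n x := by
  rw [wave, wave, ← Complex.exp_add]
  congr 1
  simp only [phase, Pi.sub_apply, mul_sub, Finset.sum_sub_distrib]
  push_cast
  ring

/-- The translation produced by the kernel variable `y` at frequency scale `r`. -/
def shift (r : ℝ) (y : EuclideanSpace ℝ (Fin 2)) : Fin 2 → ℝ := fun i => 2 * Real.pi * r⁻¹ * y i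

theorem phase_shift (n : Freq) (r : ℝ) (y : EuclideanSpace ℝ (Fin 2)) :
    phase n (shift r y) = 2 * Real.pi * inner ℝ y (r⁻¹ • n.vec) := by
  simp only [phase, shift, Fin.sum_univ_two, PiLp.inner_apply, PiLp.smul_apply, Freq.vec,
    smul_eq_mul, RCLike.inner_apply, conj_trivial]
  ring

theorem norm_shift_le {r : ℝ} (hr : 0 < r) (y : EuclideanSpace ℝ (Fin 2)) :
    ‖shift r y‖ ≤ 2 * Real.pi * r⁻¹ * ‖y‖ := by
  have hp : (0 : ℝ) ≤ 2 * Real.pi * r⁻¹ := by positivity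
  refine (pi_norm_le_iff_of_nonneg (by positivity)).2 fun i => ?_
  rw [shift, norm_mul, Real.norm_of_nonneg hp]
  exact mul_le_mul_of_nonneg_left (PiLp.norm_apply_le y i) hp

/-- Multiplying by the kernel's exponential translates the wave. The 2π in `shift` matches the
normalisation e^(2πi⟨y,ξ⟩) of the Fourier transform. -/
theorem exp_mul_wave (n : Freq) (r : ℝ) (y : EuclideanSpace ℝ (Fin 2)) (x : Fin 2 → ℝ) :
    Complex.exp (((2 * Real.pi * inner ℝ y (r⁻¹ • n.vec) : ℝ) : ℂ) * Complex.I) * wave n x =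
      wave n (x - shift r y) := by
  rw [wave_sub, phase_shift, mul_comm Complex.I]

theorem integrable_exp_mul {E : Type*} [NormedAddCommGroup E] [InnerProductSpace ℝ E]
    [FiniteDimensional ℝ E] [MeasurableSpace E] [BorelSpace E] {K : E → ℂ}
    (hK : MeasureTheory.Integrable K) (ξ : E) :
    MeasureTheory.Integrable
      (fun y => Complex.exp (((2 * Real.pi * inner ℝ y ξ : ℝ) : ℂ) * Complex.I) * K y) := by
  refine hK.bdd_mul (c := 1) (Continuous.aestronglyMeasurable (by fun_prop)) ?_
  filter_upwards with y
  rw [Complex.norm_exp]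
  simp

/-- A smooth compactly supported Fourier multiplier is bounded for the supremum norm, uniformly
in the scale. -/
theorem exists_multiplier_bound (ψ : EuclideanSpace ℝ (Fin 2) → ℂ)
    (hψ : ContDiff ℝ ∞ ψ) (hc : HasCompactSupport ψ) :
    ∃ C : ℝ, 0 ≤ C ∧ ∀ {ι : Type} (S : Finset ι) (ν : ι → Freq) (c : ι → ℂ) (r M : ℝ),
      (∀ x, ‖∑ i ∈ S, c i * wave (ν i) x‖ ≤ M) →
      ∀ x, ‖∑ i ∈ S, ψ (r⁻¹ • (ν i).vec) * (c i * wave (ν i) x)‖ ≤ C * M := by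
  obtain ⟨K, hK, -, hK'⟩ := exists_kernel ψ hψ hc
  refine ⟨∫ y, ‖K y‖, by positivity, fun S ν c r M hM x => ?_⟩
  have h : ∑ i ∈ S, ψ (r⁻¹ • (ν i).vec) * (c i * wave (ν i) x) =
      ∫ y, (∑ i ∈ S, c i * wave (ν i) (x - shift r y)) * K y := by
    simp only [hK', ← MeasureTheory.integral_mul_const, Finset.sum_mul]
    rw [← MeasureTheory.integral_finsetSum S fun i _ => (integrable_exp_mul hK _).mul_const _]
    refine MeasureTheory.integral_congr_ae (Filter.Eventually.of_forall fun y => ?_)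
    refine Finset.sum_congr rfl fun i _ => ?_
    rw [← exp_mul_wave]
    ring
  rw [h]
  calc _ ≤ ∫ y, M * ‖K y‖ := by
        refine MeasureTheory.norm_integral_le_of_norm_le (hK.norm.const_mul M) ?_
        filter_upwards with y
        rw [norm_mul]
        exact mul_le_mul_of_nonneg_right (hM _) (norm_nonneg _)
    _ = _ := by rw [MeasureTheory.integral_const_mul, mul_comm]

/-- A bilinear multiplier whose symbol vanishes when the first frequency does gains one derivative
on the first factor. -/
theorem exists_bilinear_bound
    (σ : WithLp 2 (EuclideanSpace ℝ (Fin 2) × EuclideanSpace ℝ (Fin 2)) → ℂ)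
    (hσ : ContDiff ℝ ∞ σ) (hc : HasCompactSupport σ) (h0 : ∀ η, σ (WithLp.toLp 2 (0, η)) = 0) :
    ∃ C : ℝ, 0 ≤ C ∧ ∀ (S T : Finset Freq) (a b : Freq → ℂ) (r L M : ℝ), 0 < r →
      (∀ x h, ‖(∑ k ∈ S, a k * wave k (x - h)) - ∑ k ∈ S, a k * wave k x‖ ≤ L * ‖h‖) →
      (∀ x, ‖∑ m ∈ T, b m * wave m x‖ ≤ M) → 0 ≤ L →
      ∀ x, ‖∑ k ∈ S, ∑ m ∈ T, σ (WithLp.toLp 2 (r⁻¹ • k.vec, r⁻¹ • m.vec)) *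
        ((a k * wave k x) * (b m * wave m x))‖ ≤ C * (r⁻¹ * L * M) := by
  obtain ⟨K, hK, hK1, hK'⟩ := exists_kernel σ hσ hc
  refine ⟨2 * Real.pi * ∫ y, ‖y‖ * ‖K y‖, by positivity, fun S T a b r L M hr hA hB hL x => ?_⟩
  -- Used twice: with t k = k/r, where the first factor is translated, and with t = 0, where it is
  -- not. The second integral is zero because σ(0, ·) = 0. Subtracting it turns the first factor
  -- into an increment, which the Lipschitz hypothesis bounds by L times the shift; the first moment
  -- of K absorbs the resulting ‖y‖.
  have expand : ∀ (t : Freq → EuclideanSpace ℝ (Fin 2)) (A : _ → ℂ),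
      (∀ y, A y = ∑ k ∈ S, a k * (Complex.exp (((2 * Real.pi * inner ℝ y (t k) : ℝ) : ℂ) *
        Complex.I) * wave k x)) →
      MeasureTheory.Integrable (fun y : WithLp 2 (EuclideanSpace ℝ (Fin 2) ×
          EuclideanSpace ℝ (Fin 2)) =>
          A y.fst * (∑ m ∈ T, b m * wave m (x - shift r y.snd)) * K y) ∧
      ∑ k ∈ S, ∑ m ∈ T, σ (WithLp.toLp 2 (t k, r⁻¹ • m.vec)) *
        ((a k * wave k x) * (b m * wave m x)) =
      ∫ y : WithLp 2 (EuclideanSpace ℝ (Fin 2) × EuclideanSpace ℝ (Fin 2)),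
        A y.fst * (∑ m ∈ T, b m * wave m (x - shift r y.snd)) * K y := by
    intro t A hA
    have key : ∀ y : WithLp 2 (EuclideanSpace ℝ (Fin 2) × EuclideanSpace ℝ (Fin 2)),
        A y.fst * (∑ m ∈ T, b m * wave m (x - shift r y.snd)) * K y =
        ∑ k ∈ S, ∑ m ∈ T, Complex.exp (((2 * Real.pi *
          inner ℝ y (WithLp.toLp 2 (t k, r⁻¹ • m.vec)) : ℝ) : ℂ) * Complex.I) * K y *
          ((a k * wave k x) * (b m * wave m x)) := by
      intro y
      rw [hA, Finset.sum_mul_sum, Finset.sum_mul]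
      refine Finset.sum_congr rfl fun k _ => ?_
      rw [Finset.sum_mul]
      refine Finset.sum_congr rfl fun m _ => ?_
      rw [← exp_mul_wave, WithLp.prod_inner_apply, mul_add, Complex.ofReal_add, add_mul,
        Complex.exp_add]
      simp only [WithLp.ofLp_fst, WithLp.ofLp_snd]
      ring
    simp only [key]
    refine ⟨MeasureTheory.integrable_finsetSum _ fun k _ =>
      MeasureTheory.integrable_finsetSum _ fun m _ => (integrable_exp_mul hK _).mul_const _, ?_⟩
    rw [MeasureTheory.integral_finsetSum _ fun k _ => MeasureTheory.integrable_finsetSum _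
      fun m _ => (integrable_exp_mul hK _).mul_const _]
    refine Finset.sum_congr rfl fun k _ => ?_
    rw [MeasureTheory.integral_finsetSum _ fun m _ => (integrable_exp_mul hK _).mul_const _]
    refine Finset.sum_congr rfl fun m _ => ?_
    rw [hK', MeasureTheory.integral_mul_const]
  obtain ⟨hi1, he1⟩ := expand (fun k => r⁻¹ • k.vec)
    (fun y => ∑ k ∈ S, a k * wave k (x - shift r y)) fun y => by
      simp only [exp_mul_wave]
  obtain ⟨hi2, he2⟩ := expand (fun k => 0) (fun y => ∑ k ∈ S, a k * wave k x) fun y => by simp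
  have hz : ∫ y : WithLp 2 (EuclideanSpace ℝ (Fin 2) × EuclideanSpace ℝ (Fin 2)),
      (∑ k ∈ S, a k * wave k x) * (∑ m ∈ T, b m * wave m (x - shift r y.snd)) * K y = 0 := by
    rw [← he2]
    simp [h0]
  rw [he1, ← sub_zero (∫ y, _), ← hz, ← MeasureTheory.integral_sub hi1 hi2]
  calc _ ≤ ∫ y : WithLp 2 (EuclideanSpace ℝ (Fin 2) × EuclideanSpace ℝ (Fin 2)),
        (2 * Real.pi * (r⁻¹ * L * M)) * (‖y‖ * ‖K y‖) := by
        refine MeasureTheory.norm_integral_le_of_norm_le (hK1.const_mul _) ?_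
        filter_upwards with y
        rw [← sub_mul, ← sub_mul, norm_mul, norm_mul]
        have h1 := hA x (shift r y.fst)
        have h2 := hB (x - shift r y.snd)
        have h3 := norm_shift_le hr y.fst
        have h4 : ‖y.fst‖ ≤ ‖y‖ := WithLp.norm_fst_le _ _
        have h5 : L * ‖shift r y.fst‖ ≤ L * (2 * Real.pi * r⁻¹ * ‖y‖) :=
          mul_le_mul_of_nonneg_left (h3.trans (mul_le_mul_of_nonneg_left h4 (by positivity))) hL
        have hM : 0 ≤ M := (norm_nonneg _).trans h2
        calc _ ≤ (L * (2 * Real.pi * r⁻¹ * ‖y‖)) * M * ‖K y‖ := by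
              gcongr
              exact h1.trans h5
          _ = _ := by ring
    _ = _ := by
        rw [MeasureTheory.integral_const_mul]
        ring

/-! ### Homogeneous symbols and Bernstein estimates -/

/-- The Euclidean plane of (continuous) frequencies. -/
abbrev Plane := EuclideanSpace ℝ (Fin 2)

theorem contDiff_mul_of_eventually_zero {E : Type*} [NormedAddCommGroup E] [NormedSpace ℝ E]
    {χ g : E → ℂ} (hχ : ContDiff ℝ ∞ χ)
    (h : ∀ x, ContDiffAt ℝ ∞ g x ∨ χ =ᶠ[nhds x] 0) : ContDiff ℝ ∞ fun x => χ x * g x := by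
  refine contDiff_iff_contDiffAt.2 fun x => ?_
  rcases h x with hg | h0
  · exact hχ.contDiffAt.mul hg
  · refine (contDiffAt_const (c := (0 : ℂ))).congr_of_eventuallyEq ?_
    filter_upwards [h0] with y hy
    simp [hy]

theorem eventually_zero_of_norm_le {E : Type*} [NormedAddCommGroup E] {χ : E → ℂ} {x : E} {r : ℝ}
    (hx : ‖x‖ < r) (h : ∀ ξ, χ ξ ≠ 0 → r ≤ ‖ξ‖) : χ =ᶠ[nhds x] 0 := by
  filter_upwards [(isOpen_lt continuous_norm continuous_const).mem_nhds hx] with y hy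
  by_contra hne
  exact absurd (h y hne) (not_le.2 hy)

/-- Symbols that are smooth off the origin and positively homogeneous of degree `s`. -/
structure IsHomog (g : Plane → ℂ) (s : ℝ) : Prop where
  smooth : ∀ ξ, ξ ≠ 0 → ContDiffAt ℝ ∞ g ξ
  scale : ∀ (r : ℝ) (ξ : Plane), 0 < r → g (r • ξ) = ((r ^ s : ℝ) : ℂ) * g ξ

theorem IsHomog.mul {g h : Plane → ℂ} {s t : ℝ} (hg : IsHomog g s) (hh : IsHomog h t) :
    IsHomog (fun ξ => g ξ * h ξ) (s + t) where
  smooth ξ hξ := (hg.smooth ξ hξ).mul (hh.smooth ξ hξ)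
  scale r ξ hr := by
    rw [hg.scale r ξ hr, hh.scale r ξ hr, Real.rpow_add hr]
    push_cast
    ring

theorem isHomog_one : IsHomog (fun _ => 1) 0 where
  smooth _ _ := contDiffAt_const
  scale r ξ hr := by simp

theorem isHomog_norm_rpow (s : ℝ) : IsHomog (fun ξ => ((‖ξ‖ ^ s : ℝ) : ℂ)) s where
  smooth ξ hξ := Complex.ofRealCLM.contDiff.contDiffAt.comp ξ
    ((contDiffAt_norm ℝ hξ).rpow_const_of_ne (norm_ne_zero_iff.2 hξ))
  scale r ξ hr := by
    rw [norm_smul, Real.norm_of_nonneg hr.le, Real.mul_rpow hr.le (norm_nonneg _)]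
    push_cast
    rfl

theorem isHomog_coord (i : Fin 2) : IsHomog (fun ξ => ((ξ i : ℝ) : ℂ)) 1 where
  smooth ξ _ := (Complex.ofRealCLM.contDiff.comp
    (EuclideanSpace.proj (𝕜 := ℝ) i).contDiff).contDiffAt
  scale r ξ hr := by simp

/-- The symbol of the Leray projector. -/
def leraySymb (p l : Fin 2) (ξ : Plane) : ℂ :=
  (if p = l then 1 else 0) - (ξ p : ℂ) * (ξ l : ℂ) * ((‖ξ‖ ^ (-2 : ℝ) : ℝ) : ℂ)

theorem isHomog_leraySymb (p l : Fin 2) : IsHomog (leraySymb p l) 0 := by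
  have h := ((isHomog_coord p).mul (isHomog_coord l)).mul (isHomog_norm_rpow (-2))
  refine ⟨fun ξ hξ => contDiffAt_const.sub (h.smooth ξ hξ), fun r ξ hr => ?_⟩
  have := h.scale r ξ hr
  simp only at this
  rw [leraySymb, this]
  norm_num [leraySymb]

/-- The cutoff vanishes near the origin, the only place where a homogeneous symbol may be singular,
so the product is smooth with compact support. Homogeneity then extracts the factor 2^(js) on
rescaling to unit frequency. -/
theorem exists_cutoff_multiplier_bound (χ : Plane → ℝ) (hχ : ContDiff ℝ ∞ χ)
    (hs : ∀ ξ, χ ξ ≠ 0 → 1 / 4 ≤ ‖ξ‖ ∧ ‖ξ‖ ≤ 4) {g : Plane → ℂ} {s : ℝ} (hg : IsHomog g s) :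
    ∃ C : ℝ, 0 ≤ C ∧ ∀ {ι : Type} (S : Finset ι) (ν : ι → Freq) (c : ι → ℂ) (j : ℕ) (M : ℝ),
      (∀ x, ‖∑ i ∈ S, c i * wave (ν i) x‖ ≤ M) →
      ∀ x, ‖∑ i ∈ S, (χ (((2 : ℝ) ^ j)⁻¹ • (ν i).vec) : ℂ) * g (ν i).vec *
        (c i * wave (ν i) x)‖ ≤ C * (2 ^ ((j : ℝ) * s) * M) := by
  have h0 : ∀ ξ, (χ ξ : ℂ) ≠ 0 → 1 / 4 ≤ ‖ξ‖ := fun ξ h => (hs ξ (by simpa using h)).1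
  obtain ⟨C, hC, hb⟩ := exists_multiplier_bound (fun ξ => (χ ξ : ℂ) * g ξ)
    (contDiff_mul_of_eventually_zero (Complex.ofRealCLM.contDiff.comp hχ) fun ξ => by
      by_cases hξ : ξ = 0
      · right
        exact eventually_zero_of_norm_le (χ := fun ξ => (χ ξ : ℂ)) (r := 1 / 4)
          (by simp [hξ]) h0
      · exact Or.inl (hg.smooth ξ hξ))
    (HasCompactSupport.intro (isCompact_closedBall (0 : Plane) 4) fun ξ hξ => by
      have : χ ξ = 0 := by
        by_contra h
        exact hξ (by simpa using (hs ξ h).2)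
      simp [this])
  refine ⟨C, hC, fun S ν c j M hM x => ?_⟩
  have hp : (0 : ℝ) < 2 ^ j := by positivity
  have he : ((2 : ℝ) ^ j) ^ s = 2 ^ ((j : ℝ) * s) := by
    rw [Real.rpow_mul (by norm_num), Real.rpow_natCast]
  have h1 : ∀ i, g (ν i).vec =
      ((2 ^ ((j : ℝ) * s) : ℝ) : ℂ) * g (((2 : ℝ) ^ j)⁻¹ • (ν i).vec) := by
    intro i
    rw [← he, ← hg.scale _ _ hp, smul_smul, mul_inv_cancel₀ hp.ne', one_smul]
  have h2 : ∑ i ∈ S, (χ (((2 : ℝ) ^ j)⁻¹ • (ν i).vec) : ℂ) * g (ν i).vec * (c i * wave (ν i) x) =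
      ((2 ^ ((j : ℝ) * s) : ℝ) : ℂ) * ∑ i ∈ S, ((χ (((2 : ℝ) ^ j)⁻¹ • (ν i).vec) : ℂ) *
        g (((2 : ℝ) ^ j)⁻¹ • (ν i).vec)) * (c i * wave (ν i) x) := by
    rw [Finset.mul_sum]
    refine Finset.sum_congr rfl fun i _ => ?_
    rw [h1]
    ring
  rw [h2, norm_mul, Complex.norm_real, Real.norm_of_nonneg (by positivity), mul_left_comm]
  exact mul_le_mul_of_nonneg_left (hb S ν c _ M hM x) (by positivity)

/-- A smooth even function that equals one on a ball and vanishes off a larger one. -/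
theorem exists_bump (E : Type*) [NormedAddCommGroup E] [InnerProductSpace ℝ E]
    {r R : ℝ} (hr : 0 < r) (hR : r < R) :
    ∃ χ : E → ℝ, ContDiff ℝ ∞ χ ∧ (∀ ξ, ‖ξ‖ ≤ r → χ ξ = 1) ∧
      (∀ ξ, R ≤ ‖ξ‖ → χ ξ = 0) ∧ ∀ ξ, χ (-ξ) = χ ξ := by
  let f : ContDiffBump (0 : E) := ⟨r, R, hr, hR⟩
  refine ⟨f, f.contDiff, fun ξ h => f.one_of_mem_closedBall (by simpa using h), fun ξ h =>
    f.zero_of_le_dist (by simpa using h), f.neg⟩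

/-- A smooth cutoff that equals one on the annulus supporting a Littlewood-Paley symbol. -/
theorem exists_annular_cutoff : ∃ χ : Plane → ℝ, ContDiff ℝ ∞ χ ∧
    (∀ ξ, 1 / 2 ≤ ‖ξ‖ → ‖ξ‖ ≤ 2 → χ ξ = 1) ∧ ∀ ξ, χ ξ ≠ 0 → 1 / 4 ≤ ‖ξ‖ ∧ ‖ξ‖ ≤ 4 := by
  obtain ⟨f, hf, hf1, hf0, -⟩ := exists_bump Plane (r := 2) (R := 4) (by norm_num) (by norm_num)
  obtain ⟨g, hg, hg1, hg0, -⟩ := exists_bump Plane (r := 1 / 4) (R := 1 / 2)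
    (by norm_num) (by norm_num)
  refine ⟨fun ξ => f ξ - g ξ, hf.sub hg, fun ξ h1 h2 => ?_, fun ξ hne => ?_⟩
  · simp [hf1 ξ h2, hg0 ξ h1]
  · by_contra hcon
    apply hne
    rw [not_and_or, not_le, not_le] at hcon
    rcases hcon with h | h
    · simp [hf1 ξ (by linarith), hg1 ξ h.le]
    · simp [hf0 ξ h.le, hg0 ξ (by linarith)]

/-! ### Scalar Littlewood-Paley blocks -/

namespace LittlewoodPaley

variable (φ : LittlewoodPaley)

/-- The symbol of `P_N` at the integer frequency `n`, `N = 2^j`. -/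
def dyad (j : ℕ) (n : Freq) : ℂ := (φ.symb (((2 : ℝ) ^ j)⁻¹ • n.vec) : ℂ)

/-- The frequencies seen by `P_N`. -/
def freqs (j : ℕ) : Finset Freq := (φ.finite_symb j).toFinset

/-- `P_N f` for a scalar distribution. -/
def sblock (j : ℕ) (f : Freq → ℂ) (x : Fin 2 → ℝ) : ℂ :=
  ∑ n ∈ φ.freqs j, φ.dyad j n * f n * wave n x

theorem mem_freqs {j : ℕ} {n : Freq} : n ∈ φ.freqs j ↔ φ.dyad j n ≠ 0 := by
  simp [freqs, dyad]

theorem block_apply (j : ℕ) (f : VField) (x : Fin 2 → ℝ) (i : Fin 2) :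
    φ.block j f x i = φ.sblock j (fun n => f n i) x := by
  rw [block_eq_sum, sblock]
  simp only [WithLp.ofLp_sum, Finset.sum_apply, PiLp.smul_apply, smul_eq_mul]
  refine Finset.sum_congr rfl fun n _ => ?_
  rw [dyad, wave]
  ring

theorem norm_lt_of_dyad_ne_zero {j : ℕ} {n : Freq} (h : φ.dyad j n ≠ 0) :
    (2 : ℝ) ^ j < 2 * ‖n.vec‖ ∧ ‖n.vec‖ < 2 * 2 ^ j := by
  have hp : (0 : ℝ) < 2 ^ j := by positivity
  have := φ.supp _ (by simpa [dyad] using h)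
  rw [norm_smul, norm_inv, norm_pow, Real.norm_ofNat, inv_mul_lt_iff₀ hp, lt_inv_mul_iff₀ hp]
    at this
  constructor <;> linarith [this.1, this.2]

theorem symb_bounds (ξ : Plane) (h : φ.symb ξ ≠ 0) : 1 / 4 ≤ ‖ξ‖ ∧ ‖ξ‖ ≤ 4 := by
  have := φ.supp ξ h
  constructor <;> linarith [this.1, this.2]

/-- Homogeneous multipliers after a Littlewood-Paley projector. -/
theorem exists_output_bound {g : Plane → ℂ} {s : ℝ} (hg : IsHomog g s) :
    ∃ C : ℝ, 0 ≤ C ∧ ∀ {ι : Type} (S : Finset ι) (ν : ι → Freq) (c : ι → ℂ) (j : ℕ) (M : ℝ),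
      (∀ x, ‖∑ i ∈ S, c i * wave (ν i) x‖ ≤ M) →
      ∀ x, ‖∑ i ∈ S, φ.dyad j (ν i) * g (ν i).vec * (c i * wave (ν i) x)‖ ≤
        C * (2 ^ ((j : ℝ) * s) * M) :=
  exists_cutoff_multiplier_bound φ.symb φ.smooth φ.symb_bounds hg

/-- Homogeneous multipliers on a Littlewood-Paley block. -/
theorem exists_input_bound {g : Plane → ℂ} {s : ℝ} (hg : IsHomog g s) :
    ∃ C : ℝ, 0 ≤ C ∧ ∀ (f : Freq → ℂ) (j : ℕ) (M : ℝ),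
      (∀ x, ‖φ.sblock j f x‖ ≤ M) →
      ∀ x, ‖∑ n ∈ φ.freqs j, g n.vec * (φ.dyad j n * f n) * wave n x‖ ≤
        C * (2 ^ ((j : ℝ) * s) * M) := by
  -- The hypothesis controls the block itself, so its symbol cannot serve as the cutoff again. A
  -- second cutoff, equal to one on its support, is inserted at no cost.
  obtain ⟨χ, hχ, hχ1, hχ0⟩ := exists_annular_cutoff
  obtain ⟨C, hC, hb⟩ := exists_cutoff_multiplier_bound χ hχ hχ0 hg
  refine ⟨C, hC, fun f j M hM x => ?_⟩
  have := hb (φ.freqs j) id (fun n => φ.dyad j n * f n) j M hM x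
  refine le_of_eq_of_le (congrArg _ (Finset.sum_congr rfl fun n hn => ?_)) this
  have h := φ.supp _ (show φ.symb (((2 : ℝ) ^ j)⁻¹ • n.vec) ≠ 0 by
    simpa [dyad] using (φ.mem_freqs).1 hn)
  rw [id, hχ1 _ h.1.le h.2.le]
  push_cast
  ring

/-- Bernstein: each partial derivative is a multiplier of degree one and costs 2^j on the block. The
mean value inequality along t ↦ x - t h does the rest. -/
theorem exists_lipschitz_bound :
    ∃ C : ℝ, 0 ≤ C ∧ ∀ (f : Freq → ℂ) (j : ℕ) (M : ℝ),
      (∀ x, ‖φ.sblock j f x‖ ≤ M) →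
      ∀ x h, ‖φ.sblock j f (x - h) - φ.sblock j f x‖ ≤ C * (2 ^ (j : ℝ) * M) * ‖h‖ := by
  choose C hC hb using fun i => φ.exists_input_bound (isHomog_coord i)
  refine ⟨C 0 + C 1, add_nonneg (hC 0) (hC 1), fun f j M hM x h => ?_⟩
  have hd : ∀ t : ℝ, HasDerivAt (fun t : ℝ => φ.sblock j f (x - t • h))
      (∑ i, Complex.I * (h i : ℂ) * ∑ n ∈ φ.freqs j, ((n.vec i : ℝ) : ℂ) * (φ.dyad j n * f n) *
        wave n (x - t • h)) t := by
    intro t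
    have h1 : ∀ n ∈ φ.freqs j, HasDerivAt
        (fun t : ℝ => φ.dyad j n * f n * (Complex.exp (Complex.I * (phase n h : ℂ) * (t : ℂ)) *
          wave n x))
        (φ.dyad j n * f n * ((Complex.exp (Complex.I * (phase n h : ℂ) * (t : ℂ)) *
          (Complex.I * (phase n h : ℂ) * 1)) * wave n x)) t := fun n _ =>
      (((Complex.ofRealCLM.hasDerivAt (x := t)).const_mul _).cexp.mul_const _).const_mul _
    have h2 := HasDerivAt.fun_sum h1
    have hw : ∀ (n : Freq) (t : ℝ), wave n (x - t • h) =
        Complex.exp (Complex.I * (phase n h : ℂ) * (t : ℂ)) * wave n x := by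
      intro n t
      rw [wave_sub]
      congr 2
      simp only [phase, Pi.smul_apply, smul_eq_mul]
      push_cast
      rw [mul_assoc, Finset.sum_mul]
      congr 1
      exact Finset.sum_congr rfl fun i _ => by ring
    simp only [sblock, hw]
    refine h2.congr_deriv (Eq.symm ?_)
    rw [Fin.sum_univ_two, Finset.mul_sum, Finset.mul_sum, ← Finset.sum_add_distrib]
    refine Finset.sum_congr rfl fun n _ => ?_
    simp only [phase, Fin.sum_univ_two, Freq.vec]
    push_cast
    ring
  have := norm_image_sub_le_of_norm_deriv_le_segment_01'
    (C := (C 0 + C 1) * (2 ^ (j : ℝ) * M) * ‖h‖)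
    (fun t _ => (hd t).hasDerivWithinAt) fun t _ => by
      rw [Fin.sum_univ_two]
      have key : ∀ i : Fin 2, ‖Complex.I * (h i : ℂ) * ∑ n ∈ φ.freqs j,
          ((n.vec i : ℝ) : ℂ) * (φ.dyad j n * f n) * wave n (x - t • h)‖ ≤
          ‖h‖ * (C i * (2 ^ (j : ℝ) * M)) := by
        intro i
        rw [norm_mul, norm_mul, Complex.norm_I, one_mul, Complex.norm_real]
        have h3 := hb i f j M hM (x - t • h)
        rw [mul_one] at h3
        exact mul_le_mul (norm_le_pi_norm h i) h3 (norm_nonneg _) (norm_nonneg _)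
      refine (norm_add_le _ _).trans ((add_le_add (key 0) (key 1)).trans (le_of_eq ?_))
      ring
  simpa using this

end LittlewoodPaley

namespace LittlewoodPaley

variable (φ : LittlewoodPaley)

/-! ### Bilinear estimates for pairs of Littlewood-Paley blocks -/

/-- The bilinear form with symbol `q`, applied to the blocks `P_{2^a} f` and `P_{2^b} g` and
followed by `P_{2^j}`. -/
def pair (q : Freq → Freq → ℂ) (j a b : ℕ) (f g : Freq → ℂ) (x : Fin 2 → ℝ) : ℂ :=
  ∑ k ∈ φ.freqs a, ∑ m ∈ φ.freqs b,
    φ.dyad j (k + m) * q k m * (φ.dyad a k * f k * (φ.dyad b m * g m)) * wave (k + m) x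

/-- `P_{2^j}` and Q act on the product as linear multipliers in k + m. Many pairs (k, m) share one
sum, which is why the linear bounds allow an arbitrary indexed family of frequencies. -/
theorem exists_pair_bound_of_bilinear {Q : Plane → ℂ} {s : ℝ} (hQ : IsHomog Q s) :
    ∃ C : ℝ, 0 ≤ C ∧ ∀ (w : Freq → Freq → ℂ) (f g : Freq → ℂ) (j a b : ℕ) (M : ℝ),
      (∀ x, ‖∑ k ∈ φ.freqs a, ∑ m ∈ φ.freqs b,
        w k m * ((φ.dyad a k * f k * wave k x) * (φ.dyad b m * g m * wave m x))‖ ≤ M) →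
      ∀ x, ‖φ.pair (fun k m => Q (k + m).vec * w k m) j a b f g x‖ ≤ C * (2 ^ (j * s) * M) := by
  obtain ⟨C, hC, hb⟩ := φ.exists_output_bound hQ
  refine ⟨C, hC, fun w f g j a b M hM x => ?_⟩
  have := hb (φ.freqs a ×ˢ φ.freqs b) (fun p => p.1 + p.2)
    (fun p => w p.1 p.2 * (φ.dyad a p.1 * f p.1 * (φ.dyad b p.2 * g p.2))) j M
    (fun x => by
      rw [Finset.sum_product]
      refine le_of_eq_of_le (congrArg _ ?_) (hM x)
      refine Finset.sum_congr rfl fun k _ => Finset.sum_congr rfl fun m _ => ?_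
      simp only [wave_add]
      ring) x
  rw [Finset.sum_product] at this
  refine le_of_eq_of_le (congrArg _ ?_) this
  refine Finset.sum_congr rfl fun k _ => Finset.sum_congr rfl fun m _ => ?_
  ring

/-- When the symbol splits into an output factor Q(k + m) and a factor G(m), the inner expression is
a genuine product of two functions and the sup norms multiply. -/
theorem exists_product_bound {Q G : Plane → ℂ} {s t : ℝ} (hQ : IsHomog Q s) (hG : IsHomog G t) :
    ∃ C : ℝ, 0 ≤ C ∧ ∀ (f g : Freq → ℂ) (j a b : ℕ) (M M' : ℝ),
      (∀ x, ‖φ.sblock a f x‖ ≤ M) → (∀ x, ‖φ.sblock b g x‖ ≤ M') →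
      ∀ x, ‖φ.pair (fun k m => Q (k + m).vec * G m.vec) j a b f g x‖ ≤
        C * (2 ^ (j * s) * (2 ^ (b * t) * (M * M'))) := by
  obtain ⟨C, hC, hb⟩ := φ.exists_pair_bound_of_bilinear hQ
  obtain ⟨D, hD, hb'⟩ := φ.exists_input_bound hG
  refine ⟨C * D, mul_nonneg hC hD, fun f g j a b M M' hM hM' x => ?_⟩
  refine (hb _ f g j a b (M * (D * (2 ^ (b * t) * M'))) (fun x => ?_) x).trans (le_of_eq (by ring))
  have h : ∑ k ∈ φ.freqs a, ∑ m ∈ φ.freqs b,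
      G m.vec * ((φ.dyad a k * f k * wave k x) * (φ.dyad b m * g m * wave m x)) =
      φ.sblock a f x * ∑ m ∈ φ.freqs b, G m.vec * (φ.dyad b m * g m) * wave m x := by
    rw [sblock, Finset.sum_mul_sum]
    refine Finset.sum_congr rfl fun k _ => Finset.sum_congr rfl fun m _ => ?_
    ring
  rw [h, norm_mul]
  exact mul_le_mul (hM x) (hb' g b M' hM' x) (norm_nonneg _) ((norm_nonneg _).trans (hM x))

/-- After rescaling, |η|^α |ξ + η|^(-α) - 1 is smooth as long as η and ξ + η stay away from 0, and
it vanishes at ξ = 0. Cutoffs make it a global symbol suited to `exists_bilinear_bound`. -/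
theorem exists_commutator_symbol (α : ℝ) :
    ∃ σ : WithLp 2 (Plane × Plane) → ℂ, ContDiff ℝ ∞ σ ∧ HasCompactSupport σ ∧
      (∀ η, σ (WithLp.toLp 2 (0, η)) = 0) ∧
      ∀ ξ η : Plane, ‖ξ‖ ≤ 1 / 8 → 1 / 2 ≤ ‖η‖ → ‖η‖ ≤ 2 →
        σ (WithLp.toLp 2 (ξ, η)) = ((‖η‖ ^ α * ‖ξ + η‖ ^ (-α) - 1 : ℝ) : ℂ) := by
  obtain ⟨χ, hχ, hχ1, hχ0⟩ := exists_annular_cutoff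
  -- The outer radius 1/5 is below 1/4, the inner radius of the support of χ, so ξ + η ≠ 0 wherever
  -- both cutoffs are nonzero.
  obtain ⟨ρ, hρ, hρ1, hρ0, -⟩ := exists_bump Plane (r := 1 / 8) (R := 1 / 5)
    (by norm_num) (by norm_num)
  have hfst : ContDiff ℝ ∞ fun z : WithLp 2 (Plane × Plane) => z.fst :=
    (WithLp.fstL 2 ℝ Plane Plane).contDiff
  have hsnd : ContDiff ℝ ∞ fun z : WithLp 2 (Plane × Plane) => z.snd :=
    (WithLp.sndL 2 ℝ Plane Plane).contDiff
  refine ⟨fun z => ((ρ z.fst * χ z.snd : ℝ) : ℂ) *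
    ((‖z.snd‖ ^ α * ‖z.fst + z.snd‖ ^ (-α) - 1 : ℝ) : ℂ), ?_, ?_, fun η => ?_, ?_⟩
  · refine contDiff_mul_of_eventually_zero
      (Complex.ofRealCLM.contDiff.comp ((hρ.comp hfst).mul (hχ.comp hsnd))) fun z => ?_
    by_cases hz : ‖z.snd‖ < 1 / 4
    · right
      filter_upwards [(isOpen_lt hsnd.continuous.norm continuous_const).mem_nhds hz] with y hy
      have : χ y.snd = 0 := by
        by_contra hne
        exact absurd (hχ0 _ hne).1 (not_le.2 hy)
      simp [this]
    by_cases hz' : 1 / 5 < ‖z.fst‖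
    · right
      filter_upwards [(isOpen_lt continuous_const hfst.continuous.norm).mem_nhds hz'] with y hy
      have : ρ y.fst = 0 := hρ0 _ (le_of_lt hy)
      simp [this]
    left
    have h1 : z.snd ≠ 0 := by
      intro h0
      rw [h0] at hz
      norm_num at hz
    have h2 : z.fst + z.snd ≠ 0 := by
      intro h0
      rw [eq_neg_of_add_eq_zero_left h0, norm_neg] at hz'
      linarith
    refine Complex.ofRealCLM.contDiff.contDiffAt.comp z (ContDiffAt.sub (ContDiffAt.mul ?_ ?_)
      contDiffAt_const)
    · exact ((contDiffAt_norm ℝ h1).comp z hsnd.contDiffAt).rpow_const_of_ne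
        (norm_ne_zero_iff.2 h1)
    · exact ((contDiffAt_norm ℝ h2).comp z (hfst.add hsnd).contDiffAt).rpow_const_of_ne
        (norm_ne_zero_iff.2 h2)
  · refine HasCompactSupport.intro (isCompact_closedBall 0 5) fun z hz => ?_
    by_contra hne
    have h : ρ z.fst ≠ 0 ∧ χ z.snd ≠ 0 := by
      constructor <;> intro h0 <;> simp [h0] at hne
    have h1 : ‖z.fst‖ < 1 / 5 := by
      by_contra hcon
      exact h.1 (hρ0 _ (not_lt.1 hcon))
    have h2 := (hχ0 _ h.2).2
    apply hz
    rw [mem_closedBall_zero_iff]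
    refine abs_le_of_sq_le_sq' ?_ (by norm_num) |>.2
    rw [WithLp.prod_norm_sq_eq_of_L2]
    nlinarith [norm_nonneg z.fst, norm_nonneg z.snd]
  · by_cases hη : η = 0
    · have : χ 0 = 0 := by
        by_contra hne
        have := (hχ0 _ hne).1
        norm_num at this
      simp [hη, this]
    · have : ‖η‖ ^ α * ‖η‖ ^ (-α) = 1 := by
        rw [← Real.rpow_add (norm_pos_iff.2 hη), add_neg_cancel, Real.rpow_zero]
      simp [this]
  · intro ξ η h1 h2 h3
    simp [hρ1 ξ h1, hχ1 η h2 h3]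

/-- The gain 2^(a-b) is the Lipschitz constant 2^a of the low block times the inverse scale 2^(-b)
of the high one. -/
theorem exists_commutator_bound {Q : Plane → ℂ} {s : ℝ} (hQ : IsHomog Q s) (α : ℝ) :
    ∃ C : ℝ, 0 ≤ C ∧ ∀ (f g : Freq → ℂ) (j a b : ℕ) (M M' : ℝ), a + 4 ≤ b →
      (∀ x, ‖φ.sblock a f x‖ ≤ M) → (∀ x, ‖φ.sblock b g x‖ ≤ M') →
      ∀ x, ‖φ.pair (fun k m => Q (k + m).vec *
          ((‖m.vec‖ ^ α * ‖(k + m).vec‖ ^ (-α) - 1 : ℝ) : ℂ)) j a b f g x‖ ≤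
        C * (2 ^ (j * s) * (2 ^ ((a : ℝ) - b) * (M * M'))) := by
  obtain ⟨C, hC, hb⟩ := φ.exists_pair_bound_of_bilinear hQ
  obtain ⟨σ, hσ, hσc, hσ0, hσ1⟩ := exists_commutator_symbol α
  obtain ⟨D, hD, hb'⟩ := exists_bilinear_bound σ hσ hσc hσ0
  obtain ⟨L, hL, hl⟩ := φ.exists_lipschitz_bound
  refine ⟨C * D * L, mul_nonneg (mul_nonneg hC hD) hL, fun f g j a b M M' hab hM hM' x => ?_⟩
  have hM0 : 0 ≤ M := (norm_nonneg _).trans (hM 0)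
  refine (hb _ f g j a b (D * (((2 : ℝ) ^ b)⁻¹ * (L * (2 ^ (a : ℝ) * M)) * M'))
    (fun x => ?_) x).trans (le_of_eq ?_)
  · have := hb' (φ.freqs a) (φ.freqs b) (fun k => φ.dyad a k * f k) (fun m => φ.dyad b m * g m)
      (2 ^ b) (L * (2 ^ (a : ℝ) * M)) M' (by positivity) (hl f a M hM) hM' (by positivity) x
    refine le_of_eq_of_le (congrArg _ ?_) this
    refine Finset.sum_congr rfl fun k hk => Finset.sum_congr rfl fun m hm => ?_
    have h1 := φ.norm_lt_of_dyad_ne_zero (φ.mem_freqs.1 hk)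
    have h2 := φ.norm_lt_of_dyad_ne_zero (φ.mem_freqs.1 hm)
    have hp : (0 : ℝ) < 2 ^ b := by positivity
    -- The gap of four scales places |k|/2^b, which is below 2 · 2^a/2^b, within the radius 1/8
    -- where σ is the exact commutator symbol.
    have h3 : (2 : ℝ) ^ a * 16 ≤ 2 ^ b := by
      calc (2 : ℝ) ^ a * 16 = 2 ^ (a + 4) := by rw [pow_add]; norm_num
        _ ≤ _ := pow_le_pow_right₀ (by norm_num) hab
    have hn : ∀ v : Plane, ‖((2 : ℝ) ^ b)⁻¹ • v‖ = ((2 : ℝ) ^ b)⁻¹ * ‖v‖ := fun v => by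
      rw [norm_smul, norm_inv, norm_pow, Real.norm_ofNat]
    have hvec : ((2 : ℝ) ^ b)⁻¹ • k.vec + ((2 : ℝ) ^ b)⁻¹ • m.vec =
        ((2 : ℝ) ^ b)⁻¹ • (k + m).vec := by
      ext i
      simp only [Freq.vec, PiLp.add_apply, PiLp.smul_apply, Pi.add_apply, smul_eq_mul]
      push_cast
      ring
    -- The commutator symbol is jointly homogeneous of degree zero, so rescaling does not change it.
    have hkey : (((2 : ℝ) ^ b)⁻¹ * ‖m.vec‖) ^ α * (((2 : ℝ) ^ b)⁻¹ * ‖(k + m).vec‖) ^ (-α) =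
        ‖m.vec‖ ^ α * ‖(k + m).vec‖ ^ (-α) := by
      rw [Real.mul_rpow (by positivity) (norm_nonneg _), Real.mul_rpow (by positivity)
        (norm_nonneg _), mul_mul_mul_comm, ← Real.rpow_add (by positivity), add_neg_cancel,
        Real.rpow_zero, one_mul]
    rw [hσ1 _ _ (by rw [hn, inv_mul_le_iff₀ hp]; linarith [h1.2])
      (by rw [hn, le_inv_mul_iff₀ hp]; linarith [h2.1])
      (by rw [hn, inv_mul_le_iff₀ hp]; linarith [h2.2]), hvec, hn, hn, hkey]
  · rw [Real.rpow_sub (by norm_num), Real.rpow_natCast, Real.rpow_natCast]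
    ring

/-! ### Frequency localisation -/

theorem pair_eq_zero {q : Freq → Freq → ℂ} {j a b : ℕ} {f g : Freq → ℂ} {x : Fin 2 → ℝ}
    (h : ∀ k m, φ.dyad j (k + m) ≠ 0 → φ.dyad a k ≠ 0 → φ.dyad b m ≠ 0 → False) :
    φ.pair q j a b f g x = 0 := by
  refine Finset.sum_eq_zero fun k _ => Finset.sum_eq_zero fun m _ => ?_
  by_contra hne
  refine h k m ?_ ?_ ?_ <;> intro h0 <;> simp [h0] at hne

theorem _root_.GalNS.Freq.vec_add (k m : Freq) : (k + m).vec = k.vec + m.vec := by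
  ext i
  simp [Freq.vec]

/-- The triangle inequality on the annuli: the output is at most about the larger frequency, and
comparable to it when the inputs are four scales apart. -/
theorem localisation {j a b : ℕ} {k m : Freq} (hj : φ.dyad j (k + m) ≠ 0) (ha : φ.dyad a k ≠ 0)
    (hb : φ.dyad b m ≠ 0) :
    j ≤ max a b + 2 ∧ (a + 4 ≤ b → b ≤ j + 2) ∧ (b + 4 ≤ a → a ≤ j + 2) := by
  have h1 := φ.norm_lt_of_dyad_ne_zero hj
  have h2 := φ.norm_lt_of_dyad_ne_zero ha
  have h3 := φ.norm_lt_of_dyad_ne_zero hb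
  rw [Freq.vec_add] at h1
  have h4 := norm_add_le k.vec m.vec
  have h5 : ‖m.vec‖ - ‖k.vec‖ ≤ ‖k.vec + m.vec‖ := by
    have := norm_sub_le (k.vec + m.vec) k.vec
    rw [add_sub_cancel_left] at this
    linarith
  have h6 : ‖k.vec‖ - ‖m.vec‖ ≤ ‖k.vec + m.vec‖ := by
    have := norm_sub_le (k.vec + m.vec) m.vec
    rw [add_sub_cancel_right] at this
    linarith
  have hlt : ∀ {p q : ℕ}, (2 : ℝ) ^ p < 2 ^ q → p < q := fun h =>
    (pow_lt_pow_iff_right₀ (by norm_num)).1 h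
  have hmono : ∀ {p q : ℕ}, p ≤ q → (2 : ℝ) ^ p ≤ 2 ^ q := fun h =>
    pow_le_pow_right₀ (by norm_num) h
  refine ⟨?_, fun hab => ?_, fun hab => ?_⟩
  · have : (2 : ℝ) ^ j < 2 ^ (max a b + 3) := by
      have e1 := hmono (le_max_left a b)
      have e2 := hmono (le_max_right a b)
      rw [pow_add]
      linarith [h1.1]
    have := hlt this
    omega
  · have : (2 : ℝ) ^ b < 2 ^ (j + 3) := by
      have e1 := hmono hab
      rw [pow_add] at e1 ⊢
      linarith [h1.2, h2.2, h3.1]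
    have := hlt this
    omega
  · have : (2 : ℝ) ^ a < 2 ^ (j + 3) := by
      have e1 := hmono hab
      rw [pow_add] at e1 ⊢
      linarith [h1.2, h3.2, h2.1]
    have := hlt this
    omega

end LittlewoodPaley

namespace LittlewoodPaley

variable (φ : LittlewoodPaley)

/-! ### The interaction of two blocks -/

theorem pair_add (q q' : Freq → Freq → ℂ) (j a b : ℕ) (f g : Freq → ℂ) (x : Fin 2 → ℝ) :
    φ.pair (fun k m => q k m + q' k m) j a b f g x =
      φ.pair q j a b f g x + φ.pair q' j a b f g x := by
  simp only [pair, ← Finset.sum_add_distrib]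
  refine Finset.sum_congr rfl fun k _ => Finset.sum_congr rfl fun m _ => ?_
  ring

theorem pair_const_mul (c : ℂ) (q : Freq → Freq → ℂ) (j a b : ℕ) (f g : Freq → ℂ)
    (x : Fin 2 → ℝ) :
    φ.pair (fun k m => c * q k m) j a b f g x = c * φ.pair q j a b f g x := by
  simp only [pair, Finset.mul_sum]
  refine Finset.sum_congr rfl fun k _ => Finset.sum_congr rfl fun m _ => ?_
  ring

/-- The symbol of the component `p` of `G_α` acting on the components `i` and `l`. -/
def galSymb (α : ℝ) (p l i : Fin 2) (k m : Freq) : ℂ :=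
  leraySymb p l (k + m).vec * (-(Complex.I * (((k + m).vec i : ℝ) : ℂ))) *
    ((‖m.vec‖ ^ α * ‖(k + m).vec‖ ^ (-α) - 1 : ℝ) : ℂ)

/-- The two terms of |m|^α |k + m|^(-α) - 1 are estimated separately, with the derivative on the
output. -/
theorem exists_high_high_bound (α : ℝ) (p l i : Fin 2) :
    ∃ C : ℝ, 0 ≤ C ∧ ∀ (f g : Freq → ℂ) (j a b : ℕ) (M M' : ℝ),
      (∀ x, ‖φ.sblock a f x‖ ≤ M) → (∀ x, ‖φ.sblock b g x‖ ≤ M') →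
      ∀ x, ‖φ.pair (galSymb α p l i) j a b f g x‖ ≤
        C * (2 ^ (j * (1 - α)) * (2 ^ (b * α) * (M * M')) +
          2 ^ (j * (1 : ℝ)) * (2 ^ (b * (0 : ℝ)) * (M * M'))) := by
  have hQ := (isHomog_leraySymb p l).mul (isHomog_coord i)
  obtain ⟨C, hC, hb⟩ := φ.exists_product_bound (hQ.mul (isHomog_norm_rpow (-α)))
    (isHomog_norm_rpow α)
  obtain ⟨D, hD, hb'⟩ := φ.exists_product_bound hQ isHomog_one
  refine ⟨C + D, add_nonneg hC hD, fun f g j a b M M' hM hM' x => ?_⟩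
  have hM0 : 0 ≤ M := (norm_nonneg _).trans (hM 0)
  have hM0' : 0 ≤ M' := (norm_nonneg _).trans (hM' 0)
  have hq : galSymb α p l i = fun k m => (-Complex.I) *
      ((leraySymb p l (k + m).vec * (((k + m).vec i : ℝ) : ℂ) *
        ((‖(k + m).vec‖ ^ (-α) : ℝ) : ℂ)) * ((‖m.vec‖ ^ α : ℝ) : ℂ)) +
      Complex.I * ((leraySymb p l (k + m).vec * (((k + m).vec i : ℝ) : ℂ)) * 1) := by
    funext k m
    rw [galSymb]
    push_cast
    ring
  have h1 := hb f g j a b M M' hM hM' x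
  have h2 := hb' f g j a b M M' hM hM' x
  rw [hq, pair_add, pair_const_mul, pair_const_mul]
  refine (norm_add_le _ _).trans ?_
  rw [norm_mul, norm_mul, norm_neg, Complex.norm_I, one_mul, one_mul]
  rw [zero_add, ← sub_eq_add_neg] at h1
  rw [zero_add] at h2
  set t1 := (2 : ℝ) ^ (j * (1 - α)) * (2 ^ (b * α) * (M * M'))
  set t2 := (2 : ℝ) ^ (j * (1 : ℝ)) * (2 ^ (b * (0 : ℝ)) * (M * M'))
  have e1 : 0 ≤ t1 := by positivity
  have e2 : 0 ≤ t2 := by positivity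
  nlinarith [mul_nonneg hC e2, mul_nonneg hD e1]

theorem exists_low_high_bound (α : ℝ) (p l i : Fin 2) :
    ∃ C : ℝ, 0 ≤ C ∧ ∀ (f g : Freq → ℂ) (j a b : ℕ) (M M' : ℝ), a + 4 ≤ b →
      (∀ x, ‖φ.sblock a f x‖ ≤ M) → (∀ x, ‖φ.sblock b g x‖ ≤ M') →
      ∀ x, ‖φ.pair (galSymb α p l i) j a b f g x‖ ≤
        C * (2 ^ (j * (1 : ℝ)) * (2 ^ ((a : ℝ) - b) * (M * M'))) := by
  obtain ⟨C, hC, hb⟩ := φ.exists_commutator_bound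
    ((isHomog_leraySymb p l).mul (isHomog_coord i)) α
  refine ⟨C, hC, fun f g j a b M M' hab hM hM' x => ?_⟩
  have hq : galSymb α p l i = fun k m => (-Complex.I) *
      ((leraySymb p l (k + m).vec * (((k + m).vec i : ℝ) : ℂ)) *
        ((‖m.vec‖ ^ α * ‖(k + m).vec‖ ^ (-α) - 1 : ℝ) : ℂ)) := by
    funext k m
    rw [galSymb]
    ring
  have h1 := hb f g j a b M M' hab hM hM' x
  rw [zero_add] at h1
  rw [hq, pair_const_mul, norm_mul, norm_neg, Complex.norm_I, one_mul]
  exact h1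

/-- The symbol of `G_α` once the derivative has been moved to the second factor. -/
def galSymb' (α : ℝ) (p l i : Fin 2) (k m : Freq) : ℂ :=
  leraySymb p l (k + m).vec * (-(Complex.I * ((m.vec i : ℝ) : ℂ))) *
    ((‖m.vec‖ ^ α * ‖(k + m).vec‖ ^ (-α) - 1 : ℝ) : ℂ)

theorem _root_.GalNS.Freq.vec_apply (n : Freq) (i : Fin 2) : n.vec i = (n i : ℝ) := rfl

/-- The two symbols differ by a multiple of k_i, which disappears after summation over i because u
is divergence-free. -/
theorem sum_pair_galSymb {u : VField} (hu : ∀ n, ∑ i, (n i : ℂ) * u n i = 0) (α : ℝ)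
    (p l : Fin 2) (j a b : ℕ) (g : Freq → ℂ) (x : Fin 2 → ℝ) :
    ∑ i, φ.pair (galSymb α p l i) j a b (fun n => u n i) g x =
      ∑ i, φ.pair (galSymb' α p l i) j a b (fun n => u n i) g x := by
  simp only [pair, Fin.sum_univ_two, ← Finset.sum_add_distrib]
  refine Finset.sum_congr rfl fun k _ => Finset.sum_congr rfl fun m _ => ?_
  have h := hu k
  rw [Fin.sum_univ_two] at h
  simp only [galSymb, galSymb', Freq.vec_apply, Pi.add_apply]
  push_cast
  linear_combination (-(φ.dyad j (k + m)) * leraySymb p l (k + m).vec * Complex.I *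
    (((‖m.vec‖ ^ α : ℝ) : ℂ) * ((‖(k + m).vec‖ ^ (-α) : ℝ) : ℂ) - 1) * φ.dyad a k *
    (φ.dyad b m * g m) * wave (k + m) x) * h

/-- With the derivative on the low-frequency second factor it costs 2^b, not 2^j; the two terms of
the symbol are again treated separately. -/
theorem exists_high_low_bound (α : ℝ) (p l i : Fin 2) :
    ∃ C : ℝ, 0 ≤ C ∧ ∀ (f g : Freq → ℂ) (j a b : ℕ) (M M' : ℝ),
      (∀ x, ‖φ.sblock a f x‖ ≤ M) → (∀ x, ‖φ.sblock b g x‖ ≤ M') →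
      ∀ x, ‖φ.pair (galSymb' α p l i) j a b f g x‖ ≤
        C * (2 ^ (j * (-α)) * (2 ^ (b * (1 + α)) * (M * M')) +
          2 ^ (j * (0 : ℝ)) * (2 ^ (b * (1 : ℝ)) * (M * M'))) := by
  have hQ := isHomog_leraySymb p l
  obtain ⟨C, hC, hb⟩ := φ.exists_product_bound (hQ.mul (isHomog_norm_rpow (-α)))
    ((isHomog_coord i).mul (isHomog_norm_rpow α))
  obtain ⟨D, hD, hb'⟩ := φ.exists_product_bound hQ (isHomog_coord i)
  refine ⟨C + D, add_nonneg hC hD, fun f g j a b M M' hM hM' x => ?_⟩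
  have hM0 : 0 ≤ M := (norm_nonneg _).trans (hM 0)
  have hM0' : 0 ≤ M' := (norm_nonneg _).trans (hM' 0)
  have hq : galSymb' α p l i = fun k m => (-Complex.I) *
      ((leraySymb p l (k + m).vec * ((‖(k + m).vec‖ ^ (-α) : ℝ) : ℂ)) *
        (((m.vec i : ℝ) : ℂ) * ((‖m.vec‖ ^ α : ℝ) : ℂ))) +
      Complex.I * (leraySymb p l (k + m).vec * ((m.vec i : ℝ) : ℂ)) := by
    funext k m
    rw [galSymb']
    push_cast
    ring
  have h1 := hb f g j a b M M' hM hM' x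
  have h2 := hb' f g j a b M M' hM hM' x
  rw [hq, pair_add, pair_const_mul, pair_const_mul]
  refine (norm_add_le _ _).trans ?_
  rw [norm_mul, norm_mul, norm_neg, Complex.norm_I, one_mul, one_mul]
  rw [zero_add] at h1
  set t1 := (2 : ℝ) ^ (j * (-α)) * (2 ^ (b * (1 + α)) * (M * M'))
  set t2 := (2 : ℝ) ^ (j * (0 : ℝ)) * (2 ^ (b * (1 : ℝ)) * (M * M'))
  have e1 : 0 ≤ t1 := by positivity
  have e2 : 0 ≤ t2 := by positivity
  nlinarith [mul_nonneg hC e2, mul_nonneg hD e1]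

theorem two_rpow_collect (e₁ e₂ e₃ e₄ A B : ℝ) :
    (2 : ℝ) ^ e₁ * (2 ^ e₂ * ((2 ^ e₃ * A) * (2 ^ e₄ * B))) =
      2 ^ (e₁ + e₂ + e₃ + e₄) * (A * B) := by
  rw [Real.rpow_add (by norm_num), Real.rpow_add (by norm_num), Real.rpow_add (by norm_num)]
  ring

/-! ### Dyadic exponents -/

/-- Here x is the offset from j of the lower input scale. For β ≤ 1 the term x(1 - β) is
nonpositive; for β ≥ 1 it is at most j(β - 1). The decay ε|x| is bought with jκ, since |x| ≤ j. -/
theorem low_exponent_le {β κ ε j x : ℝ} (hε : 0 < ε) (hεκ : ε ≤ κ) (hx : x ≤ 0) (hj : -j ≤ x) :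
    j * (1 - 2 * β) + x * (1 - β) ≤ -j * (min β (2 * β - 1) - κ) - ε * |x| := by
  rw [abs_of_nonpos hx]
  have h1 : -j * (min β (2 * β - 1) - κ) = -(j * min β (2 * β - 1)) + j * κ := by ring
  have hj0 : 0 ≤ j := by linarith
  have h2 : ε * -x ≤ j * κ := by
    calc ε * -x ≤ κ * j := mul_le_mul hεκ (by linarith) (by linarith) (by linarith)
      _ = _ := mul_comm _ _
  have h3 : j * (1 - 2 * β) + x * (1 - β) ≤ -(j * min β (2 * β - 1)) := by
    rcases le_total β 1 with h | h
    · have := mul_le_mul_of_nonneg_left (min_le_right β (2 * β - 1)) hj0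
      nlinarith
    · have := mul_le_mul_of_nonneg_left (min_le_left β (2 * β - 1)) hj0
      nlinarith
  linarith

/-- Here x and y are the offsets of a and b from j, and δ is the decay rate in the common input
scale. Since y ≥ -5, |y| ≤ y + 10; with |x| ≤ |y| + 3 and 2ε ≤ δ, both weights are absorbed at the
cost 10δ + 3. -/
theorem high_exponent_le {β κ ε δ j x y : ℝ} (hκ : 0 < κ) (hj : 0 ≤ j) (hε : 0 < ε)
    (hε1 : ε ≤ 1) (hδ : 2 * ε ≤ δ) (hy : -5 ≤ y) (hxy : |x - y| ≤ 3) :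
    j * (1 - 2 * β) - y * δ ≤
      -j * (min β (2 * β - 1) - κ) - ε * |x| - ε * |y| + (10 * δ + 3) := by
  have h1 : -j * (min β (2 * β - 1) - κ) = -(j * min β (2 * β - 1)) + j * κ := by ring
  have h2 := mul_le_mul_of_nonneg_left (min_le_right β (2 * β - 1)) hj
  have h3 : 0 ≤ j * κ := by positivity
  have h4 : |x| ≤ |y| + 3 := by
    have := abs_add_le (x - y) y
    rw [sub_add_cancel] at this
    linarith
  have h5 : |y| ≤ y + 10 := abs_le.2 ⟨by linarith, by linarith⟩
  have h6 : ε * |x| ≤ ε * (|y| + 3) := mul_le_mul_of_nonneg_left h4 hε.le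
  have h7 : 2 * ε * |y| ≤ δ * |y| := mul_le_mul_of_nonneg_right hδ (abs_nonneg _)
  have h8 : δ * |y| ≤ δ * (y + 10) := mul_le_mul_of_nonneg_left h5 (by linarith)
  nlinarith

/-- The three regimes are put in one form: the target power of 2^j times weights decaying in |a - j|
and |b - j|. -/
theorem exists_interaction_bound {α β κ ε : ℝ} (hα : 0 < α) (hκ : 0 < κ) (hε : 0 < ε)
    (hε1 : ε ≤ 1) (hεκ : ε ≤ κ) (hεδ : 2 * ε ≤ 2 * β - α) (p l : Fin 2) :
    ∃ C : ℝ, 0 ≤ C ∧ ∀ (u : VField) (g : Freq → ℂ) (A B : ℝ),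
      (∀ n, ∑ i, (n i : ℂ) * u n i = 0) →
      (∀ i (a : ℕ) x, ‖φ.sblock a (fun n => u n i) x‖ ≤ 2 ^ (-((a : ℝ) * β)) * A) →
      (∀ (b : ℕ) x, ‖φ.sblock b g x‖ ≤ 2 ^ (-((b : ℝ) * β)) * B) →
      ∀ (j a b : ℕ) (x : Fin 2 → ℝ),
        ‖∑ i, φ.pair (galSymb α p l i) j a b (fun n => u n i) g x‖ ≤
          C * (2 ^ (-(j : ℝ) * (min β (2 * β - 1) - κ) - ε * |(a : ℝ) - j| - ε * |(b : ℝ) - j|) *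
            (A * B)) := by
  have hβ : 0 < β := by linarith
  choose C₁ hC₁ hb₁ using fun i => φ.exists_high_high_bound α p l i
  choose C₂ hC₂ hb₂ using fun i => φ.exists_low_high_bound α p l i
  choose C₃ hC₃ hb₃ using fun i => φ.exists_high_low_bound α p l i
  -- A generous bound for all bounded errors in the exponents: replacing a scale by a neighbouring
  -- one costs a multiple of β, and `high_exponent_le` is used with δ = 2β - α and with δ = 2β.
  let K : ℝ := 30 * β + 10 * (2 * β - α) + 20
  have hS₁ : 0 ≤ ∑ i, C₁ i := Finset.sum_nonneg fun i _ => hC₁ i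
  have hS₂ : 0 ≤ ∑ i, C₂ i := Finset.sum_nonneg fun i _ => hC₂ i
  have hS₃ : 0 ≤ ∑ i, C₃ i := Finset.sum_nonneg fun i _ => hC₃ i
  refine ⟨((∑ i, C₁ i) + (∑ i, C₂ i) + ∑ i, C₃ i) * (2 * 2 ^ K), by positivity,
    fun u g A B hu hA hB j a b x => ?_⟩
  have hA0 : 0 ≤ A := nonneg_of_mul_nonneg_right ((norm_nonneg _).trans (hA 0 0 0)) (by positivity)
  have hB0 : 0 ≤ B := nonneg_of_mul_nonneg_right ((norm_nonneg _).trans (hB 0 0)) (by positivity)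
  set T : ℝ := -(j : ℝ) * (min β (2 * β - 1) - κ) - ε * |(a : ℝ) - j| - ε * |(b : ℝ) - j| with hT
  have hj0 : (0 : ℝ) ≤ j := Nat.cast_nonneg j
  have ha0 : (0 : ℝ) ≤ a := Nat.cast_nonneg a
  have hb0 : (0 : ℝ) ≤ b := Nat.cast_nonneg b
  have mono : ∀ {e : ℝ}, e ≤ T + K → (2 : ℝ) ^ e * (A * B) ≤ 2 ^ K * (2 ^ T * (A * B)) := by
    intro e he
    rw [← mul_assoc (2 ^ K), ← Real.rpow_add (by norm_num), add_comm K]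
    exact mul_le_mul_of_nonneg_right (Real.rpow_le_rpow_of_exponent_le (by norm_num) he)
      (mul_nonneg hA0 hB0)
  have hX : 0 ≤ (2 : ℝ) ^ K * (2 ^ T * (A * B)) := by positivity
  set X : ℝ := (2 : ℝ) ^ K * (2 ^ T * (A * B)) with hXdef
  suffices h : ∃ S : ℝ, S ≤ (∑ i, C₁ i) + (∑ i, C₂ i) + ∑ i, C₃ i ∧
      ‖∑ i, φ.pair (galSymb α p l i) j a b (fun n => u n i) g x‖ ≤ S * (2 * X) by
    obtain ⟨S, hS, hle⟩ := h
    refine hle.trans ((mul_le_mul_of_nonneg_right hS (by positivity)).trans (le_of_eq ?_))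
    rw [hXdef]
    ring
  -- If the scales are incompatible, no pair of frequencies contributes and the form is zero.
  by_cases hloc : j ≤ max a b + 2 ∧ (a + 4 ≤ b → b ≤ j + 2) ∧ (b + 4 ≤ a → a ≤ j + 2)
  swap
  · refine ⟨0, by positivity, ?_⟩
    rw [Finset.sum_eq_zero fun i _ => ?_]
    · simp
    · exact φ.pair_eq_zero fun k m h1 h2 h3 => hloc (φ.localisation h1 h2 h3)
  obtain ⟨hl1, hl2, hl3⟩ := hloc
  by_cases hab : a + 4 ≤ b
  · refine ⟨∑ i, C₂ i, by linarith, ?_⟩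
    rw [Finset.sum_mul]
    refine norm_sum_le_of_le _ fun i _ => ?_
    refine (hb₂ i _ g j a b _ _ hab (hA i a) (hB b) x).trans
      (mul_le_mul_of_nonneg_left ?_ (hC₂ i))
    rw [two_rpow_collect]
    refine (mono ?_).trans (by linarith)
    have hbj := hl2 hab
    have hjb : j ≤ b + 2 := by omega
    have haj : a ≤ j := by omega
    have c1 : (b : ℝ) ≤ j + 2 := by exact_mod_cast hbj
    have c2 : (j : ℝ) ≤ b + 2 := by exact_mod_cast hjb
    have c3 : (a : ℝ) ≤ j := by exact_mod_cast haj
    -- Low-high: b agrees with j up to 2, so only the offset of a matters.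
    have := low_exponent_le (β := β) (j := j) (x := a - j) hε hεκ (by linarith) (by linarith)
    have h4 : |(b : ℝ) - j| ≤ 2 := abs_le.2 ⟨by linarith, by linarith⟩
    have h5 : ε * |(b : ℝ) - j| ≤ 1 * 2 := mul_le_mul hε1 h4 (abs_nonneg _) zero_le_one
    rw [hT]
    nlinarith
  by_cases hba : b + 4 ≤ a
  · refine ⟨∑ i, C₃ i, by linarith, ?_⟩
    -- High-low: the divergence-free condition acts only on the sum over i, so it is applied before
    -- the triangle inequality.
    rw [φ.sum_pair_galSymb hu, Finset.sum_mul]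
    refine norm_sum_le_of_le _ fun i _ => ?_
    refine (hb₃ i _ g j a b _ _ (hA i a) (hB b) x).trans
      (mul_le_mul_of_nonneg_left ?_ (hC₃ i))
    rw [two_rpow_collect, two_rpow_collect, two_mul]
    have hbj := hl3 hba
    have hja : j ≤ a + 2 := by omega
    have hbj : b ≤ j := by omega
    have c1 : (a : ℝ) ≤ j + 2 := by exact_mod_cast hl3 hba
    have c2 : (j : ℝ) ≤ a + 2 := by exact_mod_cast hja
    have c3 : (b : ℝ) ≤ j := by exact_mod_cast hbj
    have := low_exponent_le (β := β) (j := j) (x := b - j) hε hεκ (by linarith) (by linarith)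
    have h4 : |(a : ℝ) - j| ≤ 2 := abs_le.2 ⟨by linarith, by linarith⟩
    have h5 : ε * |(a : ℝ) - j| ≤ 1 * 2 := mul_le_mul hε1 h4 (abs_nonneg _) zero_le_one
    refine add_le_add (mono ?_) (mono ?_) <;> rw [hT] <;> nlinarith
  · refine ⟨∑ i, C₁ i, by linarith, ?_⟩
    rw [Finset.sum_mul]
    refine norm_sum_le_of_le _ fun i _ => ?_
    refine (hb₁ i _ g j a b _ _ (hA i a) (hB b) x).trans
      (mul_le_mul_of_nonneg_left ?_ (hC₁ i))
    rw [two_rpow_collect, two_rpow_collect, two_mul]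
    -- High-high: max a b ≤ b + 3, and the output lies at most two scales above it.
    have d1 : j ≤ b + 5 := by omega
    have d2 : a ≤ b + 3 := by omega
    have d3 : b ≤ a + 3 := by omega
    have c1 : (j : ℝ) ≤ b + 5 := by exact_mod_cast d1
    have c2 : (a : ℝ) ≤ b + 3 := by exact_mod_cast d2
    have c3 : (b : ℝ) ≤ a + 3 := by exact_mod_cast d3
    have hxy : |((a : ℝ) - j) - (b - j)| ≤ 3 := abs_le.2 ⟨by linarith, by linarith⟩
    have e1 := high_exponent_le (β := β) (x := (a : ℝ) - j) (y := (b : ℝ) - j) hκ hj0 hε hε1 hεδ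
      (by linarith) hxy
    have e2 := high_exponent_le (β := β) (δ := 2 * β) (x := (a : ℝ) - j) (y := (b : ℝ) - j)
      hκ hj0 hε hε1 (by linarith) (by linarith) hxy
    refine add_le_add (mono ?_) (mono ?_)
    · rw [hT]
      nlinarith
    · rw [hT]
      nlinarith

/-! ### Summation over the dyadic scales -/

/-- Splitting at j leaves two pieces, each dominated by the same geometric series. -/
theorem exists_sum_two_rpow_le {ε : ℝ} (hε : 0 < ε) :
    ∃ C : ℝ, 0 ≤ C ∧ ∀ j J : ℕ, ∑ a ∈ Finset.range J, (2 : ℝ) ^ (-(ε * |(a : ℝ) - j|)) ≤ C := by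
  have hr : (2 : ℝ) ^ (-ε) < 1 := Real.rpow_lt_one_of_one_lt_of_neg (by norm_num) (by linarith)
  have hr0 : (0 : ℝ) ≤ 2 ^ (-ε) := by positivity
  have hs := summable_geometric_of_lt_one hr0 hr
  have hpow : ∀ n : ℕ, (2 : ℝ) ^ (-(ε * n)) = ((2 : ℝ) ^ (-ε)) ^ n := fun n => by
    rw [← Real.rpow_natCast, ← Real.rpow_mul (by norm_num)]
    ring_nf
  refine ⟨2 * ∑' n : ℕ, ((2 : ℝ) ^ (-ε)) ^ n, by positivity, fun j J => ?_⟩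
  have h1 : ∑ a ∈ Finset.range J with a < j, (2 : ℝ) ^ (-(ε * |(a : ℝ) - j|)) ≤
      ∑' n : ℕ, ((2 : ℝ) ^ (-ε)) ^ n := by
    calc _ = ∑ n ∈ (Finset.range J |>.filter (· < j)).image (fun a => j - a),
          ((2 : ℝ) ^ (-ε)) ^ n := by
          rw [Finset.sum_image]
          · refine Finset.sum_congr rfl fun a ha => ?_
            have ha' := (Finset.mem_filter.1 ha).2
            rw [← hpow, abs_sub_comm, abs_of_nonneg (by
              have : (a : ℝ) ≤ j := by exact_mod_cast ha'.le
              linarith), Nat.cast_sub ha'.le]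
          · intro a ha b hb hab
            have h1 := (Finset.mem_filter.1 ha).2
            have h2 := (Finset.mem_filter.1 hb).2
            simp only at hab
            omega
      _ ≤ _ := hs.sum_le_tsum _ fun n _ => by positivity
  have h2 : ∑ a ∈ Finset.range J with ¬ a < j, (2 : ℝ) ^ (-(ε * |(a : ℝ) - j|)) ≤
      ∑' n : ℕ, ((2 : ℝ) ^ (-ε)) ^ n := by
    calc _ = ∑ n ∈ (Finset.range J |>.filter (¬ · < j)).image (fun a => a - j),
          ((2 : ℝ) ^ (-ε)) ^ n := by
          rw [Finset.sum_image]
          · refine Finset.sum_congr rfl fun a ha => ?_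
            have ha' := not_lt.1 (Finset.mem_filter.1 ha).2
            rw [← hpow, abs_of_nonneg (by
              have : (j : ℝ) ≤ a := by exact_mod_cast ha'
              linarith), Nat.cast_sub ha']
          · intro a ha b hb hab
            have h1 := not_lt.1 (Finset.mem_filter.1 ha).2
            have h2 := not_lt.1 (Finset.mem_filter.1 hb).2
            simp only at hab
            omega
      _ ≤ _ := hs.sum_le_tsum _ fun n _ => by positivity
  rw [← Finset.sum_filter_add_sum_filter_not (Finset.range J) (· < j), two_mul]
  exact add_le_add h1 h2

/-- The bilinear estimate for finitely many blocks of the factors. -/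
theorem exists_truncated_bound {α β κ : ℝ} (hα : 0 < α) (hβ : α / 2 < β) (hκ : 0 < κ) :
    ∃ C : ℝ, 0 ≤ C ∧ ∀ (u v : VField) (A B : ℝ),
      (∀ n, ∑ i, (n i : ℂ) * u n i = 0) →
      (∀ i (a : ℕ) x, ‖φ.sblock a (fun n => u n i) x‖ ≤ 2 ^ (-((a : ℝ) * β)) * A) →
      (∀ i (b : ℕ) x, ‖φ.sblock b (fun n => v n i) x‖ ≤ 2 ^ (-((b : ℝ) * β)) * B) →
      ∀ (p : Fin 2) (j J : ℕ) (x : Fin 2 → ℝ),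
        ‖∑ a ∈ Finset.range J, ∑ b ∈ Finset.range J, ∑ l, ∑ i,
          φ.pair (galSymb α p l i) j a b (fun n => u n i) (fun n => v n l) x‖ ≤
          C * (2 ^ (-(j : ℝ) * (min β (2 * β - 1) - κ)) * (A * B)) := by
  -- The bound κ serves the low-high and high-low decay, (2β - α)/2 the high-high decay; 1 keeps the
  -- constants bounded.
  let ε : ℝ := min (min 1 κ) ((2 * β - α) / 2)
  have hε : 0 < ε := lt_min (lt_min one_pos hκ) (by linarith)
  have hε1 : ε ≤ 1 := (min_le_left _ _).trans (min_le_left _ _)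
  have hεκ : ε ≤ κ := (min_le_left _ _).trans (min_le_right _ _)
  have hεδ : 2 * ε ≤ 2 * β - α := by
    have : ε ≤ (2 * β - α) / 2 := min_le_right _ _
    linarith
  choose C hC hb using fun p l => φ.exists_interaction_bound hα hκ hε hε1 hεκ hεδ p l
  obtain ⟨D, hD, hs⟩ := exists_sum_two_rpow_le hε
  have hC' : 0 ≤ ∑ p, ∑ l, C p l :=
    Finset.sum_nonneg fun p _ => Finset.sum_nonneg fun l _ => hC p l
  refine ⟨(∑ p, ∑ l, C p l) * (D * D), by positivity, fun u v A B hu hA hB p j J x => ?_⟩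
  have hA0 : 0 ≤ A := nonneg_of_mul_nonneg_right ((norm_nonneg _).trans (hA 0 0 0)) (by positivity)
  have hB0 : 0 ≤ B := nonneg_of_mul_nonneg_right ((norm_nonneg _).trans (hB 0 0 0)) (by positivity)
  set P : ℝ := (2 : ℝ) ^ (-(j : ℝ) * (min β (2 * β - 1) - κ)) with hP
  have hP0 : 0 ≤ P := by positivity
  have key : ∀ a b : ℕ, ‖∑ l, ∑ i,
      φ.pair (galSymb α p l i) j a b (fun n => u n i) (fun n => v n l) x‖ ≤
      ((∑ p, ∑ l, C p l) * (P * (A * B))) *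
        (2 ^ (-(ε * |(a : ℝ) - j|)) * 2 ^ (-(ε * |(b : ℝ) - j|))) := by
    intro a b
    calc _ ≤ ∑ l, C p l * (2 ^ (-(j : ℝ) * (min β (2 * β - 1) - κ) - ε * |(a : ℝ) - j| -
            ε * |(b : ℝ) - j|) * (A * B)) :=
          norm_sum_le_of_le _ fun l _ => hb p l u _ A B hu hA (hB l) j a b x
      _ = (∑ l, C p l) * (P * (A * B) *
            (2 ^ (-(ε * |(a : ℝ) - j|)) * 2 ^ (-(ε * |(b : ℝ) - j|)))) := by
          rw [← Finset.sum_mul, sub_eq_add_neg, sub_eq_add_neg, Real.rpow_add (by norm_num),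
            Real.rpow_add (by norm_num), ← hP]
          ring
      _ ≤ (∑ p, ∑ l, C p l) * (P * (A * B) *
            (2 ^ (-(ε * |(a : ℝ) - j|)) * 2 ^ (-(ε * |(b : ℝ) - j|)))) := by
          refine mul_le_mul_of_nonneg_right ?_ (by positivity)
          exact Finset.single_le_sum (f := fun p => ∑ l, C p l)
            (fun p _ => Finset.sum_nonneg fun l _ => hC p l) (Finset.mem_univ p)
      _ = _ := by ring
  calc _ ≤ ∑ a ∈ Finset.range J, ∑ b ∈ Finset.range J,
        ((∑ p, ∑ l, C p l) * (P * (A * B))) *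
          (2 ^ (-(ε * |(a : ℝ) - j|)) * 2 ^ (-(ε * |(b : ℝ) - j|))) :=
        norm_sum_le_of_le _ fun a _ => norm_sum_le_of_le _ fun b _ => key a b
    _ = ((∑ p, ∑ l, C p l) * (P * (A * B))) *
          ((∑ a ∈ Finset.range J, 2 ^ (-(ε * |(a : ℝ) - j|))) *
            ∑ b ∈ Finset.range J, 2 ^ (-(ε * |(b : ℝ) - j|))) := by
        rw [Finset.sum_mul_sum, Finset.mul_sum]
        simp only [Finset.mul_sum]
    _ ≤ ((∑ p, ∑ l, C p l) * (P * (A * B))) * (D * D) := by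
        refine mul_le_mul_of_nonneg_left ?_ (by positivity)
        exact mul_le_mul (hs j J) (hs j J) (Finset.sum_nonneg fun _ _ => by positivity) hD
    _ = _ := by ring

end LittlewoodPaley

/-! ### Orthogonality of the waves -/

theorem wave_zero (x : Fin 2 → ℝ) : wave 0 x = 1 := by
  simp [wave, phase]

theorem conj_wave (n : Freq) (x : Fin 2 → ℝ) : (starRingEnd ℂ) (wave n x) = wave (-n) x := by
  rw [wave, wave, ← Complex.exp_conj]
  congr 1
  simp [phase]
  ring

theorem continuous_wave (n : Freq) : Continuous (wave n) := by
  unfold wave phase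
  fun_prop

theorem integral_exp_int (n : ℤ) :
    ∫ t in Set.Icc (0 : ℝ) (2 * Real.pi), Complex.exp (-(Complex.I * ((n : ℝ) * t : ℝ))) =
      if n = 0 then ((2 * Real.pi : ℝ) : ℂ) else 0 := by
  have hp : (0 : ℝ) ≤ 2 * Real.pi := by positivity
  rw [MeasureTheory.integral_Icc_eq_integral_Ioc, ← intervalIntegral.integral_of_le hp]
  split_ifs with h
  · simp [h]
  · have hc : -(Complex.I * (n : ℂ)) ≠ 0 := by simp [h]
    have := integral_exp_mul_complex (a := 0) (b := 2 * Real.pi) hc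
    rw [show (fun t : ℝ => Complex.exp (-(Complex.I * ((n : ℝ) * t : ℝ)))) =
      fun t : ℝ => Complex.exp (-(Complex.I * (n : ℂ)) * t) by
        funext t
        push_cast
        ring_nf, this]
    have h1 : Complex.exp (-(Complex.I * (n : ℂ)) * ((2 * Real.pi : ℝ) : ℂ)) = 1 := by
      rw [Complex.exp_eq_one_iff]
      refine ⟨-n, ?_⟩
      push_cast
      ring
    rw [h1]
    simp

theorem integral_wave (n : Freq) :
    ∫ x in Set.Icc (0 : Fin 2 → ℝ) (fun _ => 2 * Real.pi), wave n x =
      if n = 0 then (((2 * Real.pi) ^ 2 : ℝ) : ℂ) else 0 := by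
  have h1 : ∀ x, wave n x = ∏ i, Complex.exp (-(Complex.I * ((n i : ℝ) * x i : ℝ))) := by
    intro x
    rw [wave, ← Complex.exp_sum]
    congr 1
    simp only [phase]
    push_cast
    rw [Finset.mul_sum, Finset.sum_neg_distrib]
  have h2 : Set.Icc (0 : Fin 2 → ℝ) (fun _ => 2 * Real.pi) =
      Set.univ.pi fun _ => Set.Icc (0 : ℝ) (2 * Real.pi) := (Set.pi_univ_Icc _ _).symm
  simp only [h1]
  rw [h2, MeasureTheory.volume_pi, MeasureTheory.Measure.restrict_pi_pi,
    MeasureTheory.integral_fintype_prod_eq_prod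
      (fun (i : Fin 2) (t : ℝ) => Complex.exp (-(Complex.I * ((n i : ℝ) * t : ℝ))))]
  simp only [integral_exp_int, Fin.prod_univ_two]
  by_cases h : n = 0
  · simp [h]
    ring
  · rw [if_neg h]
    have : ¬ (n 0 = 0 ∧ n 1 = 0) := fun hn => h (by
      funext i
      fin_cases i
      · exact hn.1
      · exact hn.2)
    rw [not_and_or] at this
    rcases this with h | h <;> simp [h]

theorem integrableOn_box {f : (Fin 2 → ℝ) → ℂ} (hf : Continuous f) :
    MeasureTheory.IntegrableOn f (Set.Icc (0 : Fin 2 → ℝ) (fun _ => 2 * Real.pi)) :=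
  hf.integrableOn_Icc

/-- Fourier coefficients of a trigonometric polynomial. -/
theorem integral_wave_mul_sum (S : Finset Freq) (c : Freq → ℂ) (n : Freq) :
    ∫ x in Set.Icc (0 : Fin 2 → ℝ) (fun _ => 2 * Real.pi),
      wave (-n) x * ∑ m ∈ S, c m * wave m x =
      (((2 * Real.pi) ^ 2 : ℝ) : ℂ) * if n ∈ S then c n else 0 := by
  have h : ∀ x, wave (-n) x * ∑ m ∈ S, c m * wave m x = ∑ m ∈ S, c m * wave (m - n) x := by
    intro x
    rw [Finset.mul_sum]
    refine Finset.sum_congr rfl fun m _ => ?_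
    rw [sub_eq_add_neg, wave_add]
    ring
  have hi : ∀ m, MeasureTheory.IntegrableOn (fun x => c m * wave (m - n) x)
      (Set.Icc (0 : Fin 2 → ℝ) (fun _ => 2 * Real.pi)) := fun m =>
    integrableOn_box (continuous_const.mul (continuous_wave _))
  simp only [h]
  rw [MeasureTheory.integral_finsetSum _ fun m _ => hi m]
  simp only [MeasureTheory.integral_const_mul, integral_wave, sub_eq_zero]
  rw [← Finset.sum_ite_eq S n c, Finset.mul_sum]
  refine Finset.sum_congr rfl fun m _ => ?_
  by_cases hm : m = n
  · simp [hm, mul_comm]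
  · simp [hm, Ne.symm hm]

theorem measureReal_box :
    MeasureTheory.volume.real (Set.Icc (0 : Fin 2 → ℝ) (fun _ => 2 * Real.pi)) =
      (2 * Real.pi) ^ 2 := by
  rw [MeasureTheory.measureReal_def, Real.volume_Icc_pi]
  have : (0 : ℝ) ≤ 2 * Real.pi := by positivity
  simp [ENNReal.toReal_ofReal, Real.pi_pos.le]

/-- Bessel's inequality against the supremum norm. -/
theorem sum_sq_le_of_bounded (S : Finset Freq) (c : Freq → ℂ) {M : ℝ}
    (hM : ∀ x, ‖∑ n ∈ S, c n * wave n x‖ ≤ M) : ∑ n ∈ S, ‖c n‖ ^ 2 ≤ M ^ 2 := by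
  have hp : (0 : ℝ) < (2 * Real.pi) ^ 2 := by positivity
  -- Parseval: the integral of |F|² over the box is (2π)² times the sum of the squared coefficients.
  have h1 : ∫ x in Set.Icc (0 : Fin 2 → ℝ) (fun _ => 2 * Real.pi),
      (starRingEnd ℂ) (∑ n ∈ S, c n * wave n x) * ∑ n ∈ S, c n * wave n x =
      (((2 * Real.pi) ^ 2 : ℝ) : ℂ) * ((∑ n ∈ S, ‖c n‖ ^ 2 : ℝ) : ℂ) := by
    have : ∀ x, (starRingEnd ℂ) (∑ n ∈ S, c n * wave n x) * ∑ n ∈ S, c n * wave n x =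
        ∑ n ∈ S, (starRingEnd ℂ) (c n) * (wave (-n) x * ∑ m ∈ S, c m * wave m x) := by
      intro x
      rw [map_sum, Finset.sum_mul]
      refine Finset.sum_congr rfl fun n _ => ?_
      rw [map_mul, conj_wave, mul_assoc]
    have hi : ∀ n, MeasureTheory.IntegrableOn
        (fun x => (starRingEnd ℂ) (c n) * (wave (-n) x * ∑ m ∈ S, c m * wave m x))
        (Set.Icc (0 : Fin 2 → ℝ) (fun _ => 2 * Real.pi)) := fun n => integrableOn_box
      (continuous_const.mul ((continuous_wave _).mul (continuous_finsetSum _ fun m _ =>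
        continuous_const.mul (continuous_wave m))))
    simp only [this]
    rw [MeasureTheory.integral_finsetSum _ fun n _ => hi n]
    simp only [MeasureTheory.integral_const_mul, integral_wave_mul_sum]
    push_cast
    rw [Finset.mul_sum]
    refine Finset.sum_congr rfl fun n hn => ?_
    rw [if_pos hn, ← Complex.conj_mul']
    ring
  have h2 : ‖∫ x in Set.Icc (0 : Fin 2 → ℝ) (fun _ => 2 * Real.pi),
      (starRingEnd ℂ) (∑ n ∈ S, c n * wave n x) * ∑ n ∈ S, c n * wave n x‖ ≤
      M ^ 2 * (2 * Real.pi) ^ 2 := by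
    rw [← measureReal_box]
    refine MeasureTheory.norm_setIntegral_le_of_norm_le_const
      (isCompact_Icc.measure_lt_top) fun x _ => ?_
    rw [norm_mul, RCLike.norm_conj, sq]
    exact mul_le_mul (hM x) (hM x) (norm_nonneg _) ((norm_nonneg _).trans (hM x))
  rw [h1, norm_mul, Complex.norm_real, Complex.norm_real, Real.norm_of_nonneg hp.le,
    Real.norm_of_nonneg (Finset.sum_nonneg fun n _ => by positivity), mul_comm] at h2
  exact le_of_mul_le_mul_right h2 hp

namespace LittlewoodPaley

variable (φ : LittlewoodPaley)

/-! ### The dyadic partition of unity -/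

theorem dyad_zero (a : ℕ) : φ.dyad a 0 = 0 := by
  by_contra h
  have := (φ.norm_lt_of_dyad_ne_zero h).1
  have h0 : (0 : Freq).vec = 0 := by
    ext i
    simp [Freq.vec]
  rw [h0, norm_zero, mul_zero] at this
  exact absurd this (not_lt.2 (by positivity))

theorem exists_norm_dyad_le : ∃ C : ℝ, 0 ≤ C ∧ ∀ a n, ‖φ.dyad a n‖ ≤ C := by
  obtain ⟨C, hC⟩ := φ.smooth.continuous.bounded_above_of_compact_support
    (HasCompactSupport.intro (isCompact_closedBall (0 : Plane) 4) fun ξ hξ => by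
      by_contra h
      exact hξ (by simpa using (φ.symb_bounds ξ h).2))
  refine ⟨C, (norm_nonneg _).trans (hC 0), fun a n => ?_⟩
  rw [dyad, Complex.norm_real]
  exact hC _

/-- If a₀ is the first block seeing n, then |n| < 2 · 2^a₀, whereas block b requires 2^b < 2|n|; so
b < a₀ + 2. -/
theorem exists_scale {n : Freq} (hn : n ≠ 0) :
    ∃ a₀ : ℕ, (∀ a, φ.dyad a n ≠ 0 → a = a₀ ∨ a = a₀ + 1) ∧
      φ.dyad a₀ n + φ.dyad (a₀ + 1) n = 1 := by
  have hs : HasSum (fun j : ℕ => φ.dyad j n) 1 := by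
    simpa [dyad] using Complex.hasSum_ofReal.2 (φ.sum_one n.vec (Freq.one_le_norm_vec hn))
  have hex : ∃ a : ℕ, φ.dyad a n ≠ 0 := by
    by_contra! hc
    simp only [hc] at hs
    exact zero_ne_one (hasSum_zero.unique hs)
  classical
  let a₀ := Nat.find hex
  have h0 : φ.dyad a₀ n ≠ 0 := Nat.find_spec hex
  have hsup : ∀ a, φ.dyad a n ≠ 0 → a = a₀ ∨ a = a₀ + 1 := by
    intro b hb
    have h1 : a₀ ≤ b := Nat.find_min' _ hb
    have h2 := (φ.norm_lt_of_dyad_ne_zero hb).1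
    have h3 := (φ.norm_lt_of_dyad_ne_zero h0).2
    have h4 : (2 : ℝ) ^ b < 2 ^ (a₀ + 2) := by
      rw [pow_add]
      linarith
    have := (pow_lt_pow_iff_right₀ (by norm_num : (1 : ℝ) < 2)).1 h4
    omega
  refine ⟨a₀, hsup, ?_⟩
  have h5 : HasSum (fun j : ℕ => φ.dyad j n) (∑ j ∈ {a₀, a₀ + 1}, φ.dyad j n) := by
    refine hasSum_sum_of_ne_finset_zero fun b hb => ?_
    by_contra hne
    exact hb (by simpa using hsup b hne)
  rw [Finset.sum_pair (by omega)] at h5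
  exact h5.unique hs

/-- The symbol of the low-frequency projector `∑_{a < J} P_{2^a}`. -/
def lowSymb (J : ℕ) (n : Freq) : ℂ := ∑ a ∈ Finset.range J, φ.dyad a n

theorem lowSymb_eventually {n : Freq} (hn : n ≠ 0) :
    ∀ᶠ J in Filter.atTop, φ.lowSymb J n = 1 := by
  obtain ⟨a₀, h0, h1⟩ := φ.exists_scale hn
  filter_upwards [Filter.eventually_ge_atTop (a₀ + 2)] with J hJ
  rw [← h1, ← Finset.sum_pair (f := fun a => φ.dyad a n) (by omega : a₀ ≠ a₀ + 1), lowSymb]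
  refine (Finset.sum_subset ?_ fun b _ hb => ?_).symm
  · intro b hb
    simp only [Finset.mem_insert, Finset.mem_singleton] at hb
    simp only [Finset.mem_range]
    omega
  · by_contra hne
    exact hb (by simpa using h0 b hne)

/-- At most two terms are nonzero at any frequency. Uniformity in J supplies the domination in
`tendsto_sum_pair`. -/
theorem exists_norm_lowSymb_le : ∃ C : ℝ, 0 ≤ C ∧ ∀ J n, ‖φ.lowSymb J n‖ ≤ C := by
  obtain ⟨C, hC, hb⟩ := φ.exists_norm_dyad_le
  refine ⟨C + C, by positivity, fun J n => ?_⟩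
  by_cases hn : n = 0
  · simp only [lowSymb, hn, dyad_zero]
    simp [hC]
  obtain ⟨a₀, h0, h1⟩ := φ.exists_scale hn
  have : ‖φ.lowSymb J n‖ ≤ ∑ a ∈ ({a₀, a₀ + 1} : Finset ℕ), ‖φ.dyad a n‖ := by
    refine (norm_sum_le _ _).trans ?_
    rw [← Finset.sum_filter_ne_zero]
    refine Finset.sum_le_sum_of_subset_of_nonneg (fun a ha => ?_) fun _ _ _ => norm_nonneg _
    simpa using h0 a (norm_ne_zero_iff.1 (Finset.mem_filter.1 ha).2)
  rw [Finset.sum_pair (by omega)] at this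
  exact this.trans (add_le_add (hb _ _) (hb _ _))

/-! ### Summability of the convolution products -/

/-- The embedding of 𝒞^β in H^s: Bessel bounds the ℓ² norm of each block by its sup norm, and s < β
makes the sum over blocks geometric. Each frequency is then recovered from its two blocks. -/
theorem summable_rpow_mul_sq {β s A : ℝ} (hs : 0 ≤ s) (hsβ : s < β) {f : Freq → ℂ} (hf0 : f 0 = 0)
    (hf : ∀ (a : ℕ) x, ‖φ.sblock a f x‖ ≤ 2 ^ (-((a : ℝ) * β)) * A) :
    Summable fun n : Freq => (‖n.vec‖ ^ s * ‖f n‖) ^ 2 := by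
  let h : ℕ × Freq → ℝ := fun p => ((2 : ℝ) ^ ((p.1 : ℝ) * s) * ‖φ.dyad p.1 p.2 * f p.2‖) ^ 2
  have hh : 0 ≤ h := fun p => by positivity
  have hz : ∀ a, ∀ n ∉ φ.freqs a, h (a, n) = 0 := by
    intro a n hn
    have : φ.dyad a n = 0 := by
      by_contra hne
      exact hn (φ.mem_freqs.2 hne)
    simp [h, this]
  have hsum : Summable h := by
    refine (summable_prod_of_nonneg hh).2 ⟨fun a =>
      summable_of_ne_finset_zero (s := φ.freqs a) (hz a), ?_⟩
    have hr : ((2 : ℝ) ^ (s - β)) ^ 2 < 1 := by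
      have h1 : (2 : ℝ) ^ (s - β) < 1 :=
        Real.rpow_lt_one_of_one_lt_of_neg (by norm_num) (by linarith)
      have h2 : (0 : ℝ) ≤ 2 ^ (s - β) := by positivity
      nlinarith
    refine Summable.of_nonneg_of_le (fun a => tsum_nonneg fun n => hh _) (fun a => ?_)
      ((summable_geometric_of_lt_one (by positivity) hr).mul_right (A ^ 2))
    rw [tsum_eq_sum (hz a)]
    simp only [h, mul_pow]
    rw [← Finset.mul_sum]
    have h3 := sum_sq_le_of_bounded (φ.freqs a) (fun n => φ.dyad a n * f n) (hf a)
    refine (mul_le_mul_of_nonneg_left h3 (by positivity)).trans (le_of_eq ?_)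
    have e : (2 : ℝ) ^ ((a : ℝ) * s) * 2 ^ (-((a : ℝ) * β)) = (2 ^ (s - β)) ^ a := by
      rw [← Real.rpow_add (by norm_num), ← Real.rpow_natCast, ← Real.rpow_mul (by norm_num)]
      ring_nf
    calc _ = ((2 : ℝ) ^ ((a : ℝ) * s) * 2 ^ (-((a : ℝ) * β))) ^ 2 * A ^ 2 := by ring
      _ = _ := by rw [e, ← pow_mul, ← pow_mul, mul_comm a]
  have hsum' : Summable fun n => ∑' a, h (a, n) := hsum.prod_symm.prod
  have hfib : ∀ n, Summable fun a => h (a, n) := fun n => hsum.prod_symm.prod_factor n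
  refine Summable.of_nonneg_of_le (fun n => by positivity) (fun n => ?_)
    (hsum'.mul_left (2 * (2 ^ s) ^ 2))
  by_cases hn : n = 0
  · rw [hn, hf0]
    simp only [norm_zero, mul_zero]
    have : 0 ≤ ∑' a, h (a, (0 : Freq)) := tsum_nonneg fun a => hh _
    simpa using mul_nonneg (by positivity : 0 ≤ 2 * ((2 : ℝ) ^ s) ^ 2) this
  obtain ⟨a₀, -, h1⟩ := φ.exists_scale hn
  have key : ∀ a, (‖n.vec‖ ^ s * ‖φ.dyad a n * f n‖) ^ 2 ≤ (2 ^ s) ^ 2 * h (a, n) := by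
    intro a
    by_cases hd : φ.dyad a n = 0
    · simp [h, hd]
    have h2 := (φ.norm_lt_of_dyad_ne_zero hd).2.le
    have h3 : ‖n.vec‖ ^ s ≤ 2 ^ s * 2 ^ ((a : ℝ) * s) := by
      rw [Real.rpow_mul (by norm_num), ← Real.mul_rpow (by norm_num) (by positivity),
        Real.rpow_natCast]
      exact Real.rpow_le_rpow (norm_nonneg _) h2 hs
    simp only [h]
    rw [← mul_pow, ← mul_assoc]
    gcongr
  have h2 : ∑ a ∈ ({a₀, a₀ + 1} : Finset ℕ), h (a, n) ≤ ∑' a, h (a, n) :=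
    (hfib n).sum_le_tsum _ fun a _ => hh _
  rw [Finset.sum_pair (by omega)] at h2
  have h3 : ‖f n‖ ≤ ‖φ.dyad a₀ n * f n‖ + ‖φ.dyad (a₀ + 1) n * f n‖ := by
    refine le_trans (le_of_eq ?_) (norm_add_le _ _)
    rw [← add_mul, h1, one_mul]
  set X := ‖n.vec‖ ^ s with hX
  have hX0 : 0 ≤ X := by positivity
  set d := ‖φ.dyad a₀ n * f n‖
  set d' := ‖φ.dyad (a₀ + 1) n * f n‖
  calc (X * ‖f n‖) ^ 2 ≤ (X * (d + d')) ^ 2 := by gcongr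
    _ ≤ 2 * ((X * d) ^ 2 + (X * d') ^ 2) := by nlinarith [sq_nonneg (X * d - X * d')]
    _ ≤ 2 * ((2 ^ s) ^ 2 * h (a₀, n) + (2 ^ s) ^ 2 * h (a₀ + 1, n)) := by
        gcongr
        · exact key a₀
        · exact key (a₀ + 1)
    _ = 2 * (2 ^ s) ^ 2 * (h (a₀, n) + h (a₀ + 1, n)) := by ring
    _ ≤ _ := mul_le_mul_of_nonneg_left h2 (by positivity)

/-- Half of |n - k|^α is moved to the first factor through |n - k| ≤ (1 + |n|)|k|, valid for k ≠ 0.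
The inequality 2xy ≤ x² + y² then reduces to H^(α/2) summability, which is where β > α/2 enters. -/
theorem summable_convolution {α β A B : ℝ} (hα : 0 < α) (hβ : α / 2 < β) {f g : Freq → ℂ}
    (hf0 : f 0 = 0) (hg0 : g 0 = 0)
    (hf : ∀ (a : ℕ) x, ‖φ.sblock a f x‖ ≤ 2 ^ (-((a : ℝ) * β)) * A)
    (hg : ∀ (a : ℕ) x, ‖φ.sblock a g x‖ ≤ 2 ^ (-((a : ℝ) * β)) * B) (n : Freq) :
    Summable fun k : Freq => (‖(n - k).vec‖ ^ α + 1) * (‖f k‖ * ‖g (n - k)‖) := by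
  have h1 := φ.summable_rpow_mul_sq (by positivity) hβ hf0 hf
  have h2 : Summable fun k : Freq => (‖(n - k).vec‖ ^ (α / 2) * ‖g (n - k)‖) ^ 2 :=
    (Equiv.subLeft n).summable_iff.2 (φ.summable_rpow_mul_sq (by positivity) hβ hg0 hg)
  refine Summable.of_nonneg_of_le (fun k => by positivity) (fun k => ?_)
    ((h1.add h2).mul_left ((1 + ‖n.vec‖) ^ (α / 2)))
  have hc : 0 ≤ (1 + ‖n.vec‖) ^ (α / 2) := by positivity
  by_cases hk : k = 0
  · rw [hk, hf0]
    simp only [norm_zero, zero_mul, mul_zero]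
    positivity
  by_cases hm : n - k = 0
  · rw [hm, hg0]
    simp only [norm_zero, mul_zero]
    positivity
  have hk1 := Freq.one_le_norm_vec hk
  have hm1 := Freq.one_le_norm_vec hm
  set m := n - k with hmdef
  have h3 : ‖m.vec‖ ≤ (1 + ‖n.vec‖) * ‖k.vec‖ := by
    have : n.vec = m.vec + k.vec := by rw [← Freq.vec_add, hmdef, sub_add_cancel]
    have h4 : ‖m.vec‖ ≤ ‖n.vec‖ + ‖k.vec‖ := by
      rw [eq_sub_of_add_eq this.symm]
      exact norm_sub_le _ _
    nlinarith [norm_nonneg n.vec]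
  have h4 : ‖m.vec‖ ^ (α / 2) ≤ (1 + ‖n.vec‖) ^ (α / 2) * ‖k.vec‖ ^ (α / 2) := by
    rw [← Real.mul_rpow (by positivity) (norm_nonneg _)]
    exact Real.rpow_le_rpow (norm_nonneg _) h3 (by positivity)
  have h5 : ‖m.vec‖ ^ α = ‖m.vec‖ ^ (α / 2) * ‖m.vec‖ ^ (α / 2) := by
    rw [← Real.rpow_add (by linarith), add_halves]
  have h6 : 1 ≤ ‖m.vec‖ ^ α := Real.one_le_rpow hm1 hα.le
  set c := (1 + ‖n.vec‖) ^ (α / 2)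
  set X := ‖k.vec‖ ^ (α / 2)
  set Y := ‖m.vec‖ ^ (α / 2)
  have hY : 0 ≤ Y := by positivity
  have hX : 0 ≤ X := by positivity
  calc (‖m.vec‖ ^ α + 1) * (‖f k‖ * ‖g m‖) ≤ (2 * (Y * Y)) * (‖f k‖ * ‖g m‖) := by
        gcongr
        rw [h5] at h6 ⊢
        linarith
    _ ≤ (2 * ((c * X) * Y)) * (‖f k‖ * ‖g m‖) := by gcongr
    _ = c * (2 * (X * ‖f k‖) * (Y * ‖g m‖)) := by ring
    _ ≤ c * ((X * ‖f k‖) ^ 2 + (Y * ‖g m‖) ^ 2) :=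
        mul_le_mul_of_nonneg_left (two_mul_le_add_sq _ _) hc

end LittlewoodPaley

/-! ### The bilinear form behind `G_α` -/

/-- The bilinear form `|∇|^{-α} P div (u ⊗ |∇|^α v) - P div (u ⊗ v)`. -/
def galB (α : ℝ) (u v : VField) : VField :=
  fracGrad (-α) (leray (tdiv (tensor u (fracGrad α v)))) - leray (tdiv (tensor u v))

theorem leray_apply (w : VField) (n : Freq) (p : Fin 2) :
    leray w n p = ∑ l, leraySymb p l n.vec * w n l := by
  have h : ((‖n.vec‖ ^ (-2 : ℝ) : ℝ) : ℂ) = (((‖n.vec‖ ^ 2 : ℝ) : ℂ))⁻¹ := by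
    rw [Real.rpow_neg (norm_nonneg _), Real.rpow_two, Complex.ofReal_inv]
  simp only [leray, leraySymb, h, Freq.vec_apply, sub_mul, Finset.sum_sub_distrib, ite_mul, one_mul,
    zero_mul, Finset.sum_ite_eq, Finset.mem_univ, if_true, Complex.ofReal_intCast, div_eq_mul_inv]
  congr 1
  rw [Finset.sum_mul, Finset.sum_mul]
  exact Finset.sum_congr rfl fun l _ => by ring

/-- The weighted absolute convergence that makes both products defined. -/
def ConvSummable (α : ℝ) (u v : VField) : Prop :=
  ∀ (n : Freq) (i l : Fin 2),
    Summable fun k : Freq => (‖(n - k).vec‖ ^ α + 1) * (‖u k i‖ * ‖v (n - k) l‖)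

theorem ConvSummable.tensorDefined {α : ℝ} {u v : VField} (h : ConvSummable α u v) :
    TensorDefined u v := fun n i l => by
  refine Summable.of_norm_bounded (h n i l) fun k => ?_
  rw [norm_mul]
  exact le_mul_of_one_le_left (by positivity)
    (by linarith [Real.rpow_nonneg (norm_nonneg (n - k).vec) α])

theorem ConvSummable.tensorDefined_fracGrad {α : ℝ} {u v : VField} (h : ConvSummable α u v) :
    TensorDefined u (fracGrad α v) := fun n i l => by
  refine Summable.of_norm_bounded (h n i l) fun k => ?_
  simp only [fracGrad, PiLp.smul_apply, smul_eq_mul]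
  rw [norm_mul, norm_mul, Complex.norm_real, Real.norm_of_nonneg (by positivity), mul_left_comm]
  exact mul_le_mul_of_nonneg_right (by linarith) (by positivity)

/-- Absolute convergence allows the two convolution sums to be merged into one with the symbol
`galSymb`. -/
theorem galB_apply {α : ℝ} {u v : VField} (h : ConvSummable α u v) (n : Freq) (p : Fin 2) :
    galB α u v n p =
      ∑ l, ∑ i, ∑' k, LittlewoodPaley.galSymb α p l i k (n - k) * (u k i * v (n - k) l) := by
  have key : ∀ l i, ∑' k, LittlewoodPaley.galSymb α p l i k (n - k) * (u k i * v (n - k) l) =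
      leraySymb p l n.vec * (-(Complex.I * (n i : ℂ))) *
        (((‖n.vec‖ ^ (-α) : ℝ) : ℂ) * tensor u (fracGrad α v) n i l - tensor u v n i l) := by
    intro l i
    simp only [tensor, Matrix.of_apply]
    rw [← tsum_mul_left, ← ((h.tensorDefined_fracGrad n i l).mul_left _).tsum_sub
      (h.tensorDefined n i l), ← tsum_mul_left]
    refine tsum_congr fun k => ?_
    simp only [LittlewoodPaley.galSymb, add_sub_cancel, Freq.vec_apply, fracGrad, PiLp.smul_apply,
      smul_eq_mul]
    push_cast
    ring
  simp only [key, galB, Pi.sub_apply, PiLp.sub_apply, fracGrad, PiLp.smul_apply, smul_eq_mul,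
    leray_apply, tdiv]
  simp only [Fin.sum_univ_two]
  ring

theorem norm_galSymb_le (α : ℝ) (p l i : Fin 2) (n k : Freq) :
    ‖LittlewoodPaley.galSymb α p l i k (n - k)‖ ≤
      (‖leraySymb p l n.vec‖ * |(n i : ℝ)| * (‖n.vec‖ ^ (-α) + 1)) *
        (‖(n - k).vec‖ ^ α + 1) := by
  rw [LittlewoodPaley.galSymb, add_sub_cancel, norm_mul, norm_mul, norm_neg, norm_mul,
    Complex.norm_I, one_mul, Complex.norm_real, Complex.norm_real, Freq.vec_apply,
    Real.norm_eq_abs, mul_assoc _ (‖n.vec‖ ^ (-α) + 1)]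
  refine mul_le_mul_of_nonneg_left ?_ (by positivity)
  have h1 : 0 ≤ ‖(n - k).vec‖ ^ α := by positivity
  have h2 : 0 ≤ ‖n.vec‖ ^ (-α) := by positivity
  rw [Real.norm_eq_abs]
  refine (abs_sub _ _).trans ?_
  rw [abs_of_nonneg (by positivity), abs_one]
  nlinarith

/-! ### From norm bounds to block bounds, and removal of the truncation -/

namespace LittlewoodPaley

variable (φ : LittlewoodPaley)

/-- Mean-free fields whose blocks have the size prescribed by a `𝒞^β` bound. -/
structure HasBound (β A : ℝ) (u : VField) : Prop where
  meanFree : u 0 = 0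
  bound : ∀ i (a : ℕ) x, ‖φ.sblock a (fun n => u n i) x‖ ≤ 2 ^ (-((a : ℝ) * β)) * A

theorem two_pow_rpow (j : ℕ) (β : ℝ) : ((2 : ℝ) ^ j) ^ β = 2 ^ ((j : ℝ) * β) := by
  rw [Real.rpow_mul (by norm_num), Real.rpow_natCast]

theorem norm_block_le_of_besovENorm {β : ℝ} {u : VField} (h : φ.besovENorm β u < ⊤) (j : ℕ)
    (x : Fin 2 → ℝ) :
    ‖φ.block j u x‖ ≤ 2 ^ (-((j : ℝ) * β)) * (φ.besovENorm β u).toReal := by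
  have h1 : ENNReal.ofReal (((2 : ℝ) ^ j) ^ β * ‖φ.block j u x‖) ≤ φ.besovENorm β u :=
    le_iSup₂ (f := fun (j : ℕ) (x : Fin 2 → ℝ) =>
      ENNReal.ofReal (((2 : ℝ) ^ j) ^ β * ‖φ.block j u x‖)) j x
  have h2 := (ENNReal.ofReal_le_iff_le_toReal h.ne).1 h1
  rw [two_pow_rpow] at h2
  rw [Real.rpow_neg (by norm_num), le_inv_mul_iff₀ (by positivity)]
  exact h2

theorem hasBound_of_besovENorm {β : ℝ} {u : VField} (h0 : u 0 = 0) (h : φ.besovENorm β u < ⊤) :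
    φ.HasBound β (φ.besovENorm β u).toReal u :=
  ⟨h0, fun i a x => by
    rw [← block_apply]
    exact (PiLp.norm_apply_le (φ.block a u x) i).trans (φ.norm_block_le_of_besovENorm h a x)⟩

/-- The factor 2 bounds the Euclidean norm by the sum of its two components. -/
theorem besovENorm_le_of_forall {β K : ℝ} {u : VField}
    (h : ∀ i (a : ℕ) x, ‖φ.sblock a (fun n => u n i) x‖ ≤ 2 ^ (-((a : ℝ) * β)) * K) :
    φ.besovENorm β u ≤ ENNReal.ofReal (2 * K) := by
  refine iSup₂_le fun j x => ENNReal.ofReal_le_ofReal ?_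
  rw [two_pow_rpow, ← le_inv_mul_iff₀ (by positivity), ← Real.rpow_neg (by norm_num)]
  have h1 : ‖φ.block j u x‖ ≤ ∑ i, ‖φ.block j u x i‖ := by
    rw [EuclideanSpace.norm_eq]
    refine Real.sqrt_le_iff.2 ⟨by positivity, ?_⟩
    simp only [Fin.sum_univ_two]
    nlinarith [mul_nonneg (norm_nonneg (φ.block j u x 0)) (norm_nonneg (φ.block j u x 1))]
  refine h1.trans ?_
  simp only [block_apply, Fin.sum_univ_two]
  linarith [h 0 j x, h 1 j x]

theorem HasBound.convSummable {φ : LittlewoodPaley} {α β A B : ℝ} (hα : 0 < α) (hβ : α / 2 < β)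
    {u v : VField} (hu : φ.HasBound β A u) (hv : φ.HasBound β B v) : ConvSummable α u v :=
  fun n i l => φ.summable_convolution hα hβ (f := fun n => u n i) (g := fun n => v n l)
    (by simp [hu.meanFree]) (by simp [hv.meanFree]) (hu.bound i) (hv.bound l) n

/-- The change of variables n = k + m. It passes through infinite sums because the finite frequency
sets are not preserved by translation, while the symbols vanish outside them. -/
theorem pair_eq_sum_tsum (q : Freq → Freq → ℂ) (j a b : ℕ) (f g : Freq → ℂ) (x : Fin 2 → ℝ) :
    φ.pair q j a b f g x = ∑ n ∈ φ.freqs j, φ.dyad j n * wave n x *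
      ∑' k, q k (n - k) * (φ.dyad a k * f k * (φ.dyad b (n - k) * g (n - k))) := by
  have hz : ∀ {c : ℕ} {n : Freq}, n ∉ φ.freqs c → φ.dyad c n = 0 := fun hn => by
    by_contra hne
    exact hn (φ.mem_freqs.2 hne)
  have h1 : ∀ n, ∑' k, q k (n - k) * (φ.dyad a k * f k * (φ.dyad b (n - k) * g (n - k))) =
      ∑ k ∈ φ.freqs a, q k (n - k) * (φ.dyad a k * f k * (φ.dyad b (n - k) * g (n - k))) :=
    fun n => tsum_eq_sum fun k hk => by simp [hz hk]
  simp only [h1, Finset.mul_sum]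
  rw [Finset.sum_comm, pair]
  refine Finset.sum_congr rfl fun k _ => ?_
  have e1 : ∑' m, φ.dyad j (k + m) * q k m * (φ.dyad a k * f k * (φ.dyad b m * g m)) *
      wave (k + m) x = ∑ m ∈ φ.freqs b, φ.dyad j (k + m) * q k m *
        (φ.dyad a k * f k * (φ.dyad b m * g m)) * wave (k + m) x :=
    tsum_eq_sum fun m hm => by simp [hz hm]
  have e2 : ∑' n, φ.dyad j n * wave n x *
      (q k (n - k) * (φ.dyad a k * f k * (φ.dyad b (n - k) * g (n - k)))) =
      ∑ n ∈ φ.freqs j, φ.dyad j n * wave n x *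
        (q k (n - k) * (φ.dyad a k * f k * (φ.dyad b (n - k) * g (n - k)))) :=
    tsum_eq_sum fun n hn => by simp [hz hn]
  rw [← e1, ← e2, ← (Equiv.subRight k).tsum_eq]
  refine tsum_congr fun n => ?_
  simp only [Equiv.subRight_apply, add_sub_cancel]
  ring

theorem sum_pair_eq (q : Freq → Freq → ℂ) (j J : ℕ) (f g : Freq → ℂ) (x : Fin 2 → ℝ) :
    ∑ a ∈ Finset.range J, ∑ b ∈ Finset.range J, φ.pair q j a b f g x =
      ∑ n ∈ φ.freqs j, φ.dyad j n * wave n x *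
        ∑' k, q k (n - k) * (φ.lowSymb J k * f k * (φ.lowSymb J (n - k) * g (n - k))) := by
  have hs : ∀ (a b : ℕ) (n : Freq), Summable fun k =>
      q k (n - k) * (φ.dyad a k * f k * (φ.dyad b (n - k) * g (n - k))) := fun a b n => by
    refine summable_of_ne_finset_zero (s := φ.freqs a) fun k hk => ?_
    have : φ.dyad a k = 0 := by
      by_contra hne
      exact hk (φ.mem_freqs.2 hne)
    simp [this]
  have h1 : ∀ n, ∑' k, q k (n - k) *
      (φ.lowSymb J k * f k * (φ.lowSymb J (n - k) * g (n - k))) =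
      ∑ a ∈ Finset.range J, ∑ b ∈ Finset.range J,
        ∑' k, q k (n - k) * (φ.dyad a k * f k * (φ.dyad b (n - k) * g (n - k))) := by
    intro n
    simp only [← Summable.tsum_finsetSum fun b _ => hs _ b n]
    rw [← Summable.tsum_finsetSum fun a _ => summable_sum fun b _ => hs a b n]
    refine tsum_congr fun k => ?_
    simp only [lowSymb, Finset.sum_mul, Finset.mul_sum]
    exact Finset.sum_comm
  simp only [h1, pair_eq_sum_tsum]
  simp only [Finset.mul_sum]
  exact (Finset.sum_congr rfl fun a _ => Finset.sum_comm).trans Finset.sum_comm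

/-- Truncation multiplies the coefficients by `lowSymb`, which is bounded and eventually one at each
nonzero frequency; dominated convergence applies to each convolution sum. -/
theorem tendsto_sum_pair {α : ℝ} {u v : VField} (h : ConvSummable α u v) (hu : u 0 = 0)
    (hv : v 0 = 0) (p : Fin 2) (j : ℕ) (x : Fin 2 → ℝ) :
    Filter.Tendsto (fun J => ∑ a ∈ Finset.range J, ∑ b ∈ Finset.range J, ∑ l, ∑ i,
      φ.pair (galSymb α p l i) j a b (fun n => u n i) (fun n => v n l) x) Filter.atTop
      (nhds (φ.sblock j (fun n => galB α u v n p) x)) := by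
  have h1 : ∀ J, ∑ a ∈ Finset.range J, ∑ b ∈ Finset.range J, ∑ l, ∑ i,
      φ.pair (galSymb α p l i) j a b (fun n => u n i) (fun n => v n l) x =
      ∑ n ∈ φ.freqs j, φ.dyad j n * wave n x * ∑ l, ∑ i, ∑' k, galSymb α p l i k (n - k) *
        (φ.lowSymb J k * u k i * (φ.lowSymb J (n - k) * v (n - k) l)) := by
    intro J
    simp only [Fin.sum_univ_two, Finset.sum_add_distrib, sum_pair_eq, mul_add]
  have h2 : φ.sblock j (fun n => galB α u v n p) x = ∑ n ∈ φ.freqs j, φ.dyad j n * wave n x *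
      ∑ l, ∑ i, ∑' k, galSymb α p l i k (n - k) * (u k i * v (n - k) l) := by
    rw [sblock]
    refine Finset.sum_congr rfl fun n _ => ?_
    rw [galB_apply h]
    ring
  simp only [h1]
  rw [h2]
  refine tendsto_finsetSum _ fun n _ => Filter.Tendsto.const_mul _ ?_
  refine tendsto_finsetSum _ fun l _ => tendsto_finsetSum _ fun i _ => ?_
  obtain ⟨C, hC, hb⟩ := φ.exists_norm_lowSymb_le
  refine tendsto_tsum_of_dominated_convergence
    ((h n i l).mul_left ((‖leraySymb p l n.vec‖ * |(n i : ℝ)| * (‖n.vec‖ ^ (-α) + 1)) * (C * C)))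
    (fun k => ?_) (Filter.Eventually.of_forall fun J k => ?_)
  -- `lowSymb` vanishes at frequency zero for every J, so that frequency is handled by
  -- mean-freeness.
  · by_cases hk : k = 0
    · simp [hk, hu]
    by_cases hm : n - k = 0
    · simp [hm, hv]
    refine tendsto_const_nhds.congr' ?_
    filter_upwards [φ.lowSymb_eventually hk, φ.lowSymb_eventually hm] with J h3 h4
    rw [h3, h4, one_mul, one_mul]
  · rw [norm_mul, norm_mul, norm_mul, norm_mul]
    calc _ ≤ ((‖leraySymb p l n.vec‖ * |(n i : ℝ)| * (‖n.vec‖ ^ (-α) + 1)) *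
          (‖(n - k).vec‖ ^ α + 1)) * (C * ‖u k i‖ * (C * ‖v (n - k) l‖)) := by
          gcongr
          · exact norm_galSymb_le α p l i n k
          · exact hb J k
          · exact hb J (n - k)
      _ = _ := by ring

/-- The bilinear estimate. -/
theorem exists_galB_bound {α β κ : ℝ} (hα : 0 < α) (hβ : α / 2 < β) (hκ : 0 < κ) :
    ∃ C : ℝ, 0 ≤ C ∧ ∀ (u v : VField) (A B : ℝ), (∀ n, ∑ i, (n i : ℂ) * u n i = 0) →
      φ.HasBound β A u → φ.HasBound β B v →
      φ.besovENorm (min β (2 * β - 1) - κ) (galB α u v) ≤ ENNReal.ofReal (C * (A * B)) := by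
  obtain ⟨C, hC, hb⟩ := φ.exists_truncated_bound hα hβ hκ
  refine ⟨2 * C, by positivity, fun u v A B hdiv hu hv => ?_⟩
  rw [mul_assoc]
  refine φ.besovENorm_le_of_forall fun p j x => ?_
  have h := (φ.tendsto_sum_pair (hu.convSummable hα hβ hv) hu.meanFree hv.meanFree p j x).norm
  refine (le_of_tendsto' h fun J => hb u v A B hdiv hu.bound hv.bound p j J x).trans
    (le_of_eq ?_)
  rw [neg_mul]
  ring

end LittlewoodPaley

/-! ### Solenoidal fields -/

theorem Freq.vec_neg (n : Freq) : (-n).vec = -n.vec := by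
  ext i
  simp [Freq.vec]

theorem Freq.norm_vec_sq (n : Freq) : ‖n.vec‖ ^ 2 = ∑ i, (n i : ℝ) ^ 2 := by
  rw [EuclideanSpace.norm_sq_eq]
  simp [Freq.vec]

theorem sum_mul_leray (w : VField) (n : Freq) : ∑ p, (n p : ℂ) * leray w n p = 0 := by
  by_cases hn : n = 0
  · simp [hn]
  have h : ((‖n.vec‖ ^ 2 : ℝ) : ℂ) ≠ 0 := by
    have := Freq.one_le_norm_vec hn
    exact_mod_cast (by positivity : ‖n.vec‖ ^ 2 ≠ 0)
  have h2 : ((‖n.vec‖ ^ 2 : ℝ) : ℂ) = (n 0 : ℂ) ^ 2 + (n 1 : ℂ) ^ 2 := by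
    rw [Freq.norm_vec_sq]
    simp
  simp only [leray, Fin.sum_univ_two]
  field_simp
  rw [h2]
  ring

theorem conj_galSymb (α : ℝ) (p l i : Fin 2) (k m : Freq) :
    (starRingEnd ℂ) (LittlewoodPaley.galSymb α p l i k m) =
      LittlewoodPaley.galSymb α p l i (-k) (-m) := by
  have h : -k + -m = -(k + m) := by abel
  rw [LittlewoodPaley.galSymb, LittlewoodPaley.galSymb, h, Freq.vec_neg, Freq.vec_neg, norm_neg,
    norm_neg]
  simp only [leraySymb, map_mul, map_sub, map_neg, Complex.conj_ofReal, Complex.conj_I, norm_neg,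
    PiLp.neg_apply, Complex.ofReal_neg]
  split_ifs <;> simp

/-- Reality follows from k ↦ -k, the zero mean from the outer derivative, and the zero divergence
from the Leray projector. -/
theorem IsSolenoidal.galB {α : ℝ} {u v : VField} (hu : IsSolenoidal u) (hv : IsSolenoidal v)
    (h : ConvSummable α u v) : IsSolenoidal (galB α u v) where
  real n p := by
    rw [galB_apply h, galB_apply h]
    simp only [map_sum, Complex.conj_tsum, map_mul, conj_galSymb]
    refine Finset.sum_congr rfl fun l _ => Finset.sum_congr rfl fun i _ => ?_
    rw [← (Equiv.neg Freq).tsum_eq]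
    refine tsum_congr fun k => ?_
    have e : -n - -k = -(n - k) := by abel
    simp only [Equiv.neg_apply, e, hu.real, hv.real]
  meanFree := by
    ext p
    rw [galB_apply h]
    simp [LittlewoodPaley.galSymb, Freq.vec_apply]
  divFree n := by
    have : ∑ p, (n p : ℂ) * GalNS.galB α u v n p =
        ((‖n.vec‖ ^ (-α) : ℝ) : ℂ) * (∑ p, (n p : ℂ) *
          leray (tdiv (tensor u (fracGrad α v))) n p) -
        ∑ p, (n p : ℂ) * leray (tdiv (tensor u v)) n p := by
      rw [Finset.mul_sum, ← Finset.sum_sub_distrib]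
      refine Finset.sum_congr rfl fun p _ => ?_
      simp only [GalNS.galB, Pi.sub_apply, PiLp.sub_apply, fracGrad, PiLp.smul_apply, smul_eq_mul]
      ring
    rw [this, sum_mul_leray, sum_mul_leray]
    simp

/-! ### Derivatives of the waves -/

/-- The phase as a linear functional of the position. -/
def phaseCLM (n : Freq) : (Fin 2 → ℝ) →L[ℝ] ℝ :=
  ∑ i, (n i : ℝ) • ContinuousLinearMap.proj (R := ℝ) (φ := fun _ : Fin 2 => ℝ) i

theorem phaseCLM_apply (n : Freq) (x : Fin 2 → ℝ) : phaseCLM n x = phase n x := by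
  simp [phaseCLM, phase]

theorem phase_single (n : Freq) (i : Fin 2) (t : ℝ) : phase n (Pi.single i t) = n i * t := by
  simp [phase, Pi.single_apply]

theorem hasFDerivAt_wave (n : Freq) (x : Fin 2 → ℝ) :
    HasFDerivAt (wave n)
      (wave n x • (-(Complex.I • Complex.ofRealCLM.comp (phaseCLM n)))) x := by
  have h1 : HasFDerivAt (fun x => ((phaseCLM n x : ℝ) : ℂ))
      (Complex.ofRealCLM.comp (phaseCLM n)) x :=
    (Complex.ofRealCLM.comp (phaseCLM n)).hasFDerivAt
  have h2 := (h1.const_smul Complex.I).neg.cexp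
  have h3 : wave n = fun x => Complex.exp (-(Complex.I • ((phaseCLM n x : ℝ) : ℂ))) := by
    funext x
    rw [wave, phaseCLM_apply, smul_eq_mul]
  rw [h3]
  exact h2

theorem contDiff_wave (n : Freq) : ContDiff ℝ ∞ (wave n) := by
  have h3 : wave n = fun x => Complex.exp (-(Complex.I * ((phaseCLM n x : ℝ) : ℂ))) := by
    funext x
    rw [wave, phaseCLM_apply]
  rw [h3]
  exact (contDiff_const.mul (Complex.ofRealCLM.comp (phaseCLM n)).contDiff).neg.cexp

theorem wave_periodic (n : Freq) (x : Fin 2 → ℝ) (i : Fin 2) :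
    wave n (x + Pi.single i (2 * Real.pi)) = wave n x := by
  have h : x + Pi.single i (2 * Real.pi) = x - -Pi.single i (2 * Real.pi) := by abel
  rw [h, wave_sub]
  have h2 : phase n (-Pi.single i (2 * Real.pi)) = -(n i * (2 * Real.pi)) := by
    rw [← phase_single]
    simp [phase]
  have h3 : Complex.exp (Complex.I * (phase n (-Pi.single i (2 * Real.pi)) : ℂ)) = 1 := by
    rw [h2, Complex.exp_eq_one_iff]
    refine ⟨-n i, ?_⟩
    push_cast
    ring
  rw [h3, one_mul]

theorem exp_phase (n : Freq) (x : Fin 2 → ℝ) :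
    Complex.exp (Complex.I * (phase n x : ℂ)) = wave (-n) x := by
  rw [wave]
  congr 1
  simp only [phase, Pi.neg_apply]
  push_cast
  simp only [neg_mul, Finset.sum_neg_distrib, mul_neg, neg_neg]

theorem coeff_apply (U : (Fin 2 → ℝ) → (Fin 2 → ℝ)) (n : Freq) (i : Fin 2) :
    coeff U n i = (((2 * Real.pi) ^ 2 : ℝ) : ℂ)⁻¹ *
      ∫ x in Set.Icc (0 : Fin 2 → ℝ) (fun _ => 2 * Real.pi), wave (-n) x * (U x i : ℂ) := by
  simp only [coeff, exp_phase]

/-! ### Trigonometric polynomials are smooth fields -/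

theorem IsSolenoidal.exists_smooth {f : VField} (hf : IsSolenoidal f) (S : Finset Freq)
    (hS : ∀ n ∉ S, f n = 0) : ∃ U, IsSmoothSolenoidal U ∧ coeff U = f := by
  let T : Fin 2 → (Fin 2 → ℝ) → ℂ := fun i x => ∑ n ∈ S, f n i * wave n x
  let U : (Fin 2 → ℝ) → (Fin 2 → ℝ) := fun x i => (T i x).re
  have hT : ∀ i x, ((U x i : ℝ) : ℂ) = T i x := by
    intro i x
    refine Complex.conj_eq_iff_re.1 ?_
    have h1 : T i x = ∑' n, f n i * wave n x :=
      (tsum_eq_sum fun n hn => by simp [hS n hn]).symm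
    rw [h1, Complex.conj_tsum, ← (Equiv.neg Freq).tsum_eq]
    refine tsum_congr fun n => ?_
    rw [map_mul, Equiv.neg_apply, conj_wave, hf.real, neg_neg, Complex.conj_conj]
  have hcoeff : coeff U = f := by
    funext n
    ext i
    rw [coeff_apply]
    simp only [hT, T]
    rw [integral_wave_mul_sum, inv_mul_cancel_left₀ (by
      have : (2 * Real.pi) ^ 2 ≠ 0 := by positivity
      exact_mod_cast this)]
    split_ifs with h
    · rfl
    · simp [hS n h]
  have hd : ∀ x, HasFDerivAt U (ContinuousLinearMap.pi fun i => Complex.reCLM.comp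
      (∑ n ∈ S, f n i • (wave n x • (-(Complex.I • Complex.ofRealCLM.comp (phaseCLM n)))))) x := by
    intro x
    refine hasFDerivAt_pi.2 fun i => ?_
    exact Complex.reCLM.hasFDerivAt.comp x (HasFDerivAt.fun_sum fun n _ =>
      (hasFDerivAt_wave n x).const_smul (f n i))
  refine ⟨U, ⟨?_, fun x i => ?_, fun x => ?_, fun i => ?_⟩, hcoeff⟩
  · refine contDiff_pi.2 fun i => Complex.reCLM.contDiff.comp ?_
    exact ContDiff.sum fun n _ => contDiff_const.mul (contDiff_wave n)
  · funext l
    simp only [U, T, wave_periodic]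
  · rw [(hd x).fderiv]
    have h1 : ∀ i, (∑ n ∈ S, f n i • (wave n x • (-(Complex.I •
        Complex.ofRealCLM.comp (phaseCLM n))))) (Pi.single i 1) =
        ∑ n ∈ S, -(Complex.I * wave n x) * ((n i : ℂ) * f n i) := by
      intro i
      rw [sum_apply]
      refine Finset.sum_congr rfl fun n _ => ?_
      simp only [smul_apply, neg_apply,
        ContinuousLinearMap.comp_apply, phaseCLM_apply, phase_single, smul_eq_mul, mul_one,
        Complex.ofRealCLM_apply, Complex.ofReal_intCast]
      ring
    simp only [ContinuousLinearMap.coe_pi', ContinuousLinearMap.comp_apply, h1,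
      Complex.reCLM_apply]
    rw [← Complex.re_sum, Finset.sum_comm]
    simp only [← Finset.mul_sum, hf.divFree, mul_zero, Finset.sum_const_zero, Complex.zero_re]
  · have h1 : coeff U 0 i = 0 := by rw [hcoeff, hf.meanFree]; rfl
    rw [coeff_apply] at h1
    simp only [neg_zero, wave_zero, one_mul] at h1
    rw [mul_eq_zero, or_iff_right (by
      have : (2 * Real.pi) ^ 2 ≠ 0 := by positivity
      exact inv_ne_zero (by exact_mod_cast this)), integral_complex_ofReal] at h1
    exact_mod_cast h1

/-! ### Fourier coefficients of smooth solenoidal fields -/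

/-- For the divergence, integrate that of e^(in·x) U over the box. It equals i n · U e^(in·x)
because div U = 0, and the boundary terms cancel by periodicity. -/
theorem IsSmoothSolenoidal.isSolenoidal_coeff {U : (Fin 2 → ℝ) → (Fin 2 → ℝ)}
    (hU : IsSmoothSolenoidal U) : IsSolenoidal (coeff U) where
  real n i := by
    rw [coeff_apply, coeff_apply, map_mul, ← integral_conj, map_inv₀, Complex.conj_ofReal]
    congr 2
    funext x
    rw [map_mul, conj_wave, Complex.conj_ofReal]
  meanFree := by
    ext i
    rw [coeff_apply]
    simp only [neg_zero, wave_zero, one_mul]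
    rw [integral_complex_ofReal, hU.meanFree]
    simp
  divFree n := by
    have hd : ∀ x, HasFDerivAt U (fderiv ℝ U x) x := fun x =>
      (hU.smooth.differentiable (by simp) x).hasFDerivAt
    let f : (Fin 2 → ℝ) → Fin 2 → ℂ := fun x i => wave (-n) x * (U x i : ℂ)
    let f' : (Fin 2 → ℝ) → (Fin 2 → ℝ) →L[ℝ] Fin 2 → ℂ := fun x => ContinuousLinearMap.pi fun i =>
      wave (-n) x • Complex.ofRealCLM.comp
          ((ContinuousLinearMap.proj (R := ℝ) (φ := fun _ : Fin 2 => ℝ) i).comp (fderiv ℝ U x)) +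
        (U x i : ℂ) • (wave (-n) x • (-(Complex.I • Complex.ofRealCLM.comp (phaseCLM (-n)))))
    have hf : ∀ x, HasFDerivAt f (f' x) x := by
      intro x
      refine hasFDerivAt_pi.2 fun i => ?_
      have h1 : HasFDerivAt (fun x => ((U x i : ℝ) : ℂ)) (Complex.ofRealCLM.comp
          ((ContinuousLinearMap.proj (R := ℝ) (φ := fun _ : Fin 2 => ℝ) i).comp (fderiv ℝ U x)))
          x :=
        Complex.ofRealCLM.hasFDerivAt.comp x
          ((ContinuousLinearMap.proj (R := ℝ) (φ := fun _ : Fin 2 => ℝ) i).hasFDerivAt.comp x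
            (hd x))
      exact (hasFDerivAt_wave (-n) x).mul h1
    have hdiv : ∀ x, ∑ i, f' x (Pi.single i 1) i =
        Complex.I * ∑ i, (n i : ℂ) * (wave (-n) x * (U x i : ℂ)) := by
      intro x
      have h1 : ((∑ i, fderiv ℝ U x (Pi.single i 1) i : ℝ) : ℂ) = 0 := by
        rw [hU.divFree, Complex.ofReal_zero]
      have h2 : ∀ i, f' x (Pi.single i 1) i = wave (-n) x *
          ((fderiv ℝ U x (Pi.single i 1) i : ℝ) : ℂ) +
          Complex.I * ((n i : ℂ) * (wave (-n) x * (U x i : ℂ))) := by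
        intro i
        simp only [f', ContinuousLinearMap.coe_pi', add_apply,
          smul_apply, neg_apply,
          ContinuousLinearMap.comp_apply, phaseCLM_apply, phase_single, smul_eq_mul, mul_one,
          Complex.ofRealCLM_apply, ContinuousLinearMap.proj_apply,
          Pi.neg_apply, Int.cast_neg]
        push_cast
        ring
      simp only [h2]
      rw [Finset.sum_add_distrib, ← Finset.mul_sum, ← Finset.mul_sum, ← Complex.ofReal_sum, h1,
        mul_zero, zero_add]
    have hUc : ∀ i, Continuous fun x => U x i := fun i =>
      (continuous_apply i).comp hU.smooth.continuous
    have hc : Continuous f := continuous_pi fun i =>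
      (continuous_wave _).mul (Complex.continuous_ofReal.comp (hUc i))
    have hper : ∀ x i, f (x + Pi.single i (2 * Real.pi)) = f x := by
      intro x i
      funext l
      simp only [f, wave_periodic, hU.periodic]
    have key := MeasureTheory.integral_divergence_of_hasFDerivAt_off_countable
      (0 : Fin 2 → ℝ) (fun _ => 2 * Real.pi) (fun _ => by simp [Real.pi_pos.le]) f f' ∅
      Set.countable_empty hc.continuousOn (fun x _ => hf x) (by
        simp only [hdiv]
        refine integrableOn_box (continuous_const.mul (continuous_finsetSum _ fun i _ =>
          continuous_const.mul ((continuous_apply i).comp hc))))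
    have hface : ∀ (i : Fin 2) (y : Fin 1 → ℝ),
        f (i.insertNth (2 * Real.pi) y) = f (i.insertNth (0 : ℝ) y) := by
      intro i y
      rw [← hper (i.insertNth (0 : ℝ) y) i]
      congr 1
      rw [eq_comm]
      refine Fin.eq_insertNth_iff.2 ⟨by simp, ?_⟩
      funext l
      simp [Fin.removeNth]
    simp only [hface, Pi.zero_apply, sub_self, Finset.sum_const_zero, hdiv] at key
    rw [MeasureTheory.integral_const_mul, mul_eq_zero, or_iff_right Complex.I_ne_zero,
      MeasureTheory.integral_finsetSum _ fun i _ => integrableOn_box (f := fun x => (n i : ℂ) *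
        (wave (-n) x * (U x i : ℂ))) (continuous_const.mul ((continuous_apply i).comp hc))] at key
    simp only [MeasureTheory.integral_const_mul] at key
    simp only [coeff_apply, mul_left_comm ((n _ : ℤ) : ℂ)]
    rw [← Finset.mul_sum, key, mul_zero]

namespace LittlewoodPaley

variable (φ : LittlewoodPaley)

/-! ### Density of smooth fields -/

/-- A solenoidal field of finite `𝒞^s` norm is a limit of smooth solenoidal fields in every
`𝒞^{s'}` with `s' < s`. -/
theorem mem_holderBesovSubmodule {s s' : ℝ} (hs : s' < s) {f : VField} (hf : IsSolenoidal f)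
    (hfin : φ.besovENorm s f < ⊤) : f ∈ φ.holderBesovSubmodule s' := by
  -- Evenness of ρ keeps the truncated field real.
  obtain ⟨ρ, hρ, hρ1, hρ0, hρe⟩ := exists_bump Plane (r := 1) (R := 2) (by norm_num) (by norm_num)
  obtain ⟨C, hC, hb⟩ := exists_multiplier_bound (fun ξ => (ρ ξ : ℂ))
    (Complex.ofRealCLM.contDiff.comp hρ)
    (HasCompactSupport.intro (isCompact_closedBall (0 : Plane) 2) fun ξ hξ => by
      rw [hρ0 ξ (by simpa using (le_of_not_ge (by simpa using hξ)))]
      simp)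
  set A := (φ.besovENorm s f).toReal
  have hA : 0 ≤ A := ENNReal.toReal_nonneg
  have hbd := φ.hasBound_of_besovENorm hf.meanFree hfin
  let t : ℕ → VField := fun J n => (ρ (((2 : ℝ) ^ J)⁻¹ • n.vec) : ℂ) • f n
  have ht : ∀ J, IsSolenoidal (t J) := fun J => by
    refine ⟨fun n i => ?_, ?_, fun n => ?_⟩
    · simp only [t, PiLp.smul_apply, smul_eq_mul, Freq.vec_neg, smul_neg, hρe, map_mul, hf.real,
        Complex.conj_ofReal]
    · simp only [t, hf.meanFree, smul_zero]
    · simp only [t, PiLp.smul_apply, smul_eq_mul, mul_left_comm ((n _ : ℤ) : ℂ)]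
      rw [← Finset.mul_sum, hf.divFree, mul_zero]
  have hsupp : ∀ J, ∀ n ∉ (Freq.finite_norm_lt (2 ^ J * 2)).toFinset, t J n = 0 := by
    intro J n hn
    have h1 : 2 ^ J * 2 ≤ ‖n.vec‖ := by simpa using hn
    simp only [t]
    rw [hρ0 _ (by
      rw [norm_smul, norm_inv, norm_pow, Real.norm_ofNat, le_inv_mul_iff₀ (by positivity)]
      exact h1), Complex.ofReal_zero, zero_smul]
  have hdiff : ∀ J i (j : ℕ) x, ‖φ.sblock j (fun n => (f - t J) n i) x‖ ≤
      2 ^ (-((j : ℝ) * s')) * ((1 + C) * A * 2 ^ (-((J : ℝ) * (s - s'))) * 2 ^ (s - s')) := by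
    intro J i j x
    -- Such blocks lie where the truncation is the identity. On the others J ≤ j + 1, so the surplus
    -- decay 2^(-j(s-s')) is at most 2^(-(J-1)(s-s')).
    by_cases hj : j + 1 ≤ J
    · rw [sblock, Finset.sum_eq_zero fun n hn => ?_]
      · rw [norm_zero]
        positivity
      have h1 := (φ.norm_lt_of_dyad_ne_zero (φ.mem_freqs.1 hn)).2
      have h2 : (2 : ℝ) ^ (j + 1) ≤ 2 ^ J := pow_le_pow_right₀ (by norm_num) hj
      have h3 : ρ (((2 : ℝ) ^ J)⁻¹ • n.vec) = 1 := hρ1 _ (by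
        rw [norm_smul, norm_inv, norm_pow, Real.norm_ofNat, inv_mul_le_iff₀ (by positivity)]
        rw [pow_succ] at h2
        linarith)
      simp [t, h3]
    · have h1 : ‖φ.sblock j (fun n => (f - t J) n i) x‖ ≤
          2 ^ (-((j : ℝ) * s)) * A + C * (2 ^ (-((j : ℝ) * s)) * A) := by
        have h2 := hb (φ.freqs j) id (fun n => φ.dyad j n * f n i) (2 ^ J) _ (hbd.bound i j) x
        have h3 : φ.sblock j (fun n => (f - t J) n i) x = φ.sblock j (fun n => f n i) x -
            ∑ n ∈ φ.freqs j, (ρ (((2 : ℝ) ^ J)⁻¹ • (id n).vec) : ℂ) *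
              (φ.dyad j n * f n i * wave (id n) x) := by
          simp only [sblock, ← Finset.sum_sub_distrib, t, Pi.sub_apply, PiLp.sub_apply,
            PiLp.smul_apply, smul_eq_mul, id]
          exact Finset.sum_congr rfl fun n _ => by ring
        rw [h3]
        exact (norm_sub_le _ _).trans (add_le_add (hbd.bound i j x) h2)
      have hJ : (J : ℝ) ≤ j + 1 := by
        have : J ≤ j + 1 := by omega
        exact_mod_cast this
      have h4 : (2 : ℝ) ^ (-((j : ℝ) * s)) ≤
          2 ^ (-((j : ℝ) * s')) * (2 ^ (-((J : ℝ) * (s - s'))) * 2 ^ (s - s')) := by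
        rw [← Real.rpow_add (by norm_num), ← Real.rpow_add (by norm_num)]
        refine Real.rpow_le_rpow_of_exponent_le (by norm_num) ?_
        nlinarith
      calc _ ≤ 2 ^ (-((j : ℝ) * s)) * A + C * (2 ^ (-((j : ℝ) * s)) * A) := h1
        _ = 2 ^ (-((j : ℝ) * s)) * ((1 + C) * A) := by ring
        _ ≤ (2 ^ (-((j : ℝ) * s')) * (2 ^ (-((J : ℝ) * (s - s'))) * 2 ^ (s - s'))) *
            ((1 + C) * A) := mul_le_mul_of_nonneg_right h4 (by positivity)
        _ = _ := by ring
  have hnorm : ∀ J, φ.besovENorm s' (f - t J) ≤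
      ENNReal.ofReal (2 * ((1 + C) * A * 2 ^ (-((J : ℝ) * (s - s'))) * 2 ^ (s - s'))) :=
    fun J => φ.besovENorm_le_of_forall (hdiff J)
  refine ⟨hf.meanFree, ?_, fun ε hε => ?_⟩
  · refine (φ.besovENorm_le_of_forall (K := A) fun i a x => (hbd.bound i a x).trans ?_).trans_lt
      ENNReal.ofReal_lt_top
    refine mul_le_mul_of_nonneg_right (Real.rpow_le_rpow_of_exponent_le (by norm_num) ?_) hA
    have : (0 : ℝ) ≤ a := Nat.cast_nonneg a
    nlinarith
  · have hr : (2 : ℝ) ^ (-(s - s')) < 1 :=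
      Real.rpow_lt_one_of_one_lt_of_neg (by norm_num) (by linarith)
    have hlim : Filter.Tendsto (fun J : ℕ =>
        2 * ((1 + C) * A * 2 ^ (-((J : ℝ) * (s - s'))) * 2 ^ (s - s'))) Filter.atTop (nhds 0) := by
      have h1 := tendsto_pow_atTop_nhds_zero_of_lt_one (by positivity) hr
      have h2 := ((h1.const_mul ((1 + C) * A)).mul_const (2 ^ (s - s'))).const_mul 2
      simp only [mul_zero, zero_mul] at h2
      refine h2.congr fun J => ?_
      rw [← Real.rpow_natCast, ← Real.rpow_mul (by norm_num)]
      ring_nf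
    obtain ⟨J, hJ⟩ := (hlim.eventually (ge_mem_nhds hε)).exists
    obtain ⟨U, hU, hU'⟩ := (ht J).exists_smooth _ (hsupp J)
    exact ⟨U, hU, by rw [hU']; exact (hnorm J).trans (ENNReal.ofReal_le_ofReal hJ)⟩

/-! ### Fields in the closure are solenoidal -/

/-- Some block sees n, and Bessel bounds a single coefficient by the sup norm of that block. Hence
Fourier coefficients are continuous in the norm. -/
theorem exists_coeff_bound (β : ℝ) {n : Freq} (hn : n ≠ 0) :
    ∃ K : ℝ, 0 ≤ K ∧ ∀ (w : VField) (ε : ℝ), 0 ≤ ε → φ.besovENorm β w ≤ ENNReal.ofReal ε →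
      ∀ i, ‖w n i‖ ≤ K * ε := by
  obtain ⟨j, hj⟩ : ∃ j, φ.dyad j n ≠ 0 := by
    obtain ⟨a₀, -, h⟩ := φ.exists_scale hn
    by_contra! hc
    simp [hc] at h
  have hj0 : 0 < ‖φ.dyad j n‖ := norm_pos_iff.2 hj
  refine ⟨‖φ.dyad j n‖⁻¹ * 2 ^ (-((j : ℝ) * β)), by positivity, fun w ε hε hw i => ?_⟩
  have hfin : φ.besovENorm β w < ⊤ := hw.trans_lt ENNReal.ofReal_lt_top
  have h1 : ∀ x, ‖∑ m ∈ φ.freqs j, φ.dyad j m * w m i * wave m x‖ ≤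
      2 ^ (-((j : ℝ) * β)) * ε := fun x => by
    have h2 := φ.block_apply j w x i
    rw [sblock] at h2
    rw [← h2]
    refine (PiLp.norm_apply_le _ i).trans ((φ.norm_block_le_of_besovENorm hfin j x).trans ?_)
    refine mul_le_mul_of_nonneg_left ?_ (by positivity)
    exact ENNReal.toReal_le_of_le_ofReal hε hw
  have h3 := sum_sq_le_of_bounded (φ.freqs j) (fun m => φ.dyad j m * w m i) h1
  have h4 : ‖φ.dyad j n * w n i‖ ^ 2 ≤ (2 ^ (-((j : ℝ) * β)) * ε) ^ 2 :=
    (Finset.single_le_sum (f := fun m => ‖φ.dyad j m * w m i‖ ^ 2) (fun _ _ => by positivity)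
      (φ.mem_freqs.2 hj)).trans h3
  have h5 := (sq_le_sq₀ (norm_nonneg _) (by positivity)).1 h4
  rw [norm_mul] at h5
  rw [mul_assoc, le_inv_mul_iff₀ hj0]
  exact h5

theorem eq_zero_of_forall_norm_le {z : ℂ} {K : ℝ} (h : ∀ ε : ℝ, 0 < ε → ‖z‖ ≤ K * ε) : z = 0 := by
  refine norm_le_zero_iff.1 (le_of_forall_pos_le_add fun ε hε => ?_)
  rw [zero_add]
  have h1 := h (ε / (|K| + 1)) (by positivity)
  refine h1.trans ?_
  rw [mul_div_assoc', div_le_iff₀ (by positivity)]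
  nlinarith [le_abs_self K]

/-- Reality and zero divergence are closed real-linear conditions on finitely many coefficients at a
time, so they pass to the limit from smooth fields. -/
theorem isSolenoidal_of_mem {β : ℝ} {u : VField} (hu : u ∈ φ.holderBesovSubmodule β) :
    IsSolenoidal u := by
  obtain ⟨h0, -, happ⟩ := hu
  refine ⟨fun n i => ?_, h0, fun n => ?_⟩
  · by_cases hn : n = 0
    · simp [hn, h0]
    obtain ⟨K, hK, hb⟩ := φ.exists_coeff_bound β hn
    obtain ⟨L, hL, hb'⟩ := φ.exists_coeff_bound β (neg_ne_zero.2 hn)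
    refine sub_eq_zero.1 (eq_zero_of_forall_norm_le (K := L + K) fun ε hε => ?_)
    obtain ⟨U, hU, hU'⟩ := happ ε hε
    have h1 := hb _ ε hε.le hU' i
    have h2 := hb' _ ε hε.le hU' i
    have h3 : u (-n) i - (starRingEnd ℂ) (u n i) =
        (u - coeff U) (-n) i - (starRingEnd ℂ) ((u - coeff U) n i) := by
      simp only [Pi.sub_apply, PiLp.sub_apply, map_sub, hU.isSolenoidal_coeff.real]
      ring
    rw [h3, add_mul]
    refine (norm_sub_le _ _).trans (add_le_add h2 ?_)
    rw [RCLike.norm_conj]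
    exact h1
  · by_cases hn : n = 0
    · simp [hn]
    obtain ⟨K, hK, hb⟩ := φ.exists_coeff_bound β hn
    refine eq_zero_of_forall_norm_le (K := ∑ i, ‖(n i : ℂ)‖ * K) fun ε hε => ?_
    obtain ⟨U, hU, hU'⟩ := happ ε hε
    have h3 : ∑ i, (n i : ℂ) * u n i = ∑ i, (n i : ℂ) * (u - coeff U) n i := by
      simp only [Pi.sub_apply, PiLp.sub_apply, mul_sub, Finset.sum_sub_distrib,
        hU.isSolenoidal_coeff.divFree, sub_zero]
    rw [h3, Finset.sum_mul]
    refine norm_sum_le_of_le _ fun i _ => ?_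
    rw [norm_mul, mul_assoc]
    exact mul_le_mul_of_nonneg_left (hb _ ε hε.le hU' i) (norm_nonneg _)

/-! ### The bounded bilinear map between Hölder-Besov spaces -/

theorem HolderBesov.hasBound {φ : LittlewoodPaley} {β : ℝ} (u : φ.HolderBesov β) :
    φ.HasBound β ‖u‖ u.toField :=
  φ.hasBound_of_besovENorm u.2.1 u.2.2.1

theorem HolderBesov.isSolenoidal {φ : LittlewoodPaley} {β : ℝ} (u : φ.HolderBesov β) :
    IsSolenoidal u.toField :=
  φ.isSolenoidal_of_mem u.2

end LittlewoodPaley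

theorem ConvSummable.summable_galSymb {α : ℝ} {u v : VField} (h : ConvSummable α u v)
    (p l i : Fin 2) (n : Freq) : Summable fun k =>
      LittlewoodPaley.galSymb α p l i k (n - k) * (u k i * v (n - k) l) := by
  refine Summable.of_norm_bounded ((h n i l).mul_left
    (‖leraySymb p l n.vec‖ * |(n i : ℝ)| * (‖n.vec‖ ^ (-α) + 1))) fun k => ?_
  rw [norm_mul, norm_mul (u k i)]
  exact (mul_le_mul_of_nonneg_right (norm_galSymb_le α p l i n k)
    (by positivity : 0 ≤ ‖u k i‖ * ‖v (n - k) l‖)).trans (le_of_eq (mul_assoc _ _ _))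

/-- The convergence hypotheses are needed because `tsum` of a divergent family is zero by
convention. -/
theorem galB_add_left {α : ℝ} {u u' v : VField} (h : ConvSummable α u v)
    (h' : ConvSummable α u' v) (hs : ConvSummable α (u + u') v) :
    galB α (u + u') v = galB α u v + galB α u' v := by
  funext n
  ext p
  simp only [Pi.add_apply, PiLp.add_apply, galB_apply h, galB_apply h', galB_apply hs,
    ← Finset.sum_add_distrib]
  refine Finset.sum_congr rfl fun l _ => Finset.sum_congr rfl fun i _ => ?_
  rw [← (h.summable_galSymb p l i n).tsum_add (h'.summable_galSymb p l i n)]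
  exact tsum_congr fun k => by ring

theorem galB_add_right {α : ℝ} {u v v' : VField} (h : ConvSummable α u v)
    (h' : ConvSummable α u v') (hs : ConvSummable α u (v + v')) :
    galB α u (v + v') = galB α u v + galB α u v' := by
  funext n
  ext p
  simp only [Pi.add_apply, PiLp.add_apply, galB_apply h, galB_apply h', galB_apply hs,
    ← Finset.sum_add_distrib]
  refine Finset.sum_congr rfl fun l _ => Finset.sum_congr rfl fun i _ => ?_
  rw [← (h.summable_galSymb p l i n).tsum_add (h'.summable_galSymb p l i n)]
  exact tsum_congr fun k => by ring

theorem galB_smul_left {α : ℝ} {u v : VField} (c : ℝ) (h : ConvSummable α u v)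
    (hs : ConvSummable α (c • u) v) : galB α (c • u) v = c • galB α u v := by
  funext n
  ext p
  simp only [Pi.smul_apply, PiLp.smul_apply, galB_apply h, galB_apply hs, Complex.real_smul,
    Finset.mul_sum, ← tsum_mul_left]
  refine Finset.sum_congr rfl fun l _ => Finset.sum_congr rfl fun i _ => ?_
  exact tsum_congr fun k => by ring

theorem galB_smul_right {α : ℝ} {u v : VField} (c : ℝ) (h : ConvSummable α u v)
    (hs : ConvSummable α u (c • v)) : galB α u (c • v) = c • galB α u v := by
  funext n
  ext p
  simp only [Pi.smul_apply, PiLp.smul_apply, galB_apply h, galB_apply hs, Complex.real_smul,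
    Finset.mul_sum, ← tsum_mul_left]
  refine Finset.sum_congr rfl fun l _ => Finset.sum_congr rfl fun i _ => ?_
  exact tsum_congr fun k => by ring

/-- `G_α` is the diagonal of a bounded bilinear map between Hölder-Besov spaces. -/
theorem exists_bilinear_galB (φ : LittlewoodPaley) {α β κ : ℝ} (hα : 0 < α) (hβ : α / 2 < β)
    (hκ : 0 < κ) :
    ∃ B : φ.HolderBesov β →L[ℝ] φ.HolderBesov β →L[ℝ] φ.HolderBesov (min β (2 * β - 1) - κ),
      ∀ u v, (B u v).toField = galB α u.toField v.toField := by
  obtain ⟨C, hC, hb⟩ := φ.exists_galB_bound hα hβ hκ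
  -- The bound with κ/2 gives finiteness in a slightly smoother space, hence membership in the
  -- closure at the target exponent.
  obtain ⟨D, -, hb'⟩ := φ.exists_galB_bound hα hβ (half_pos hκ)
  have hconv : ∀ u v : φ.HolderBesov β, ConvSummable α u.toField v.toField := fun u v =>
    u.hasBound.convSummable hα hβ v.hasBound
  have hmem : ∀ u v : φ.HolderBesov β,
      galB α u.toField v.toField ∈ φ.holderBesovSubmodule (min β (2 * β - 1) - κ) := fun u v =>
    φ.mem_holderBesovSubmodule (s := min β (2 * β - 1) - κ / 2) (by linarith)
      (u.isSolenoidal.galB v.isSolenoidal (hconv u v))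
      ((hb' _ _ _ _ u.isSolenoidal.divFree u.hasBound v.hasBound).trans_lt ENNReal.ofReal_lt_top)
  let M : φ.HolderBesov β → φ.HolderBesov β → φ.HolderBesov (min β (2 * β - 1) - κ) :=
    fun u v => ⟨galB α u.toField v.toField, hmem u v⟩
  let L : φ.HolderBesov β →ₗ[ℝ] φ.HolderBesov β →ₗ[ℝ] φ.HolderBesov (min β (2 * β - 1) - κ) :=
    LinearMap.mk₂ ℝ M
      (fun u u' v => Subtype.ext (galB_add_left (hconv u v) (hconv u' v) (hconv (u + u') v)))
      (fun c u v => Subtype.ext (galB_smul_left c (hconv u v) (hconv (c • u) v)))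
      (fun u v v' => Subtype.ext (galB_add_right (hconv u v) (hconv u v') (hconv u (v + v'))))
      (fun c u v => Subtype.ext (galB_smul_right c (hconv u v) (hconv u (c • v))))
  refine ⟨L.mkContinuous₂ C fun u v => ?_, fun u v => rfl⟩
  rw [mul_assoc]
  exact ENNReal.toReal_le_of_le_ofReal
    (mul_nonneg hC (mul_nonneg (norm_nonneg u) (norm_nonneg v)))
    (hb _ _ _ _ u.isSolenoidal.divFree u.hasBound v.hasBound)

/-! ### Uniform smoothness of quadratic maps -/

theorem exists_norm_iteratedFDeriv_id_le {X : Type*} [NormedAddCommGroup X] [NormedSpace ℝ X]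
    (k : ℕ) {R : ℝ} (hR : 0 ≤ R) :
    ∃ C : ℝ, 0 ≤ C ∧ ∀ x : X, ‖x‖ ≤ R → ‖iteratedFDeriv ℝ k (fun y : X => y) x‖ ≤ C := by
  rcases k with _ | k
  · exact ⟨R, hR, fun x hx => by rwa [norm_iteratedFDeriv_zero]⟩
  · have h : fderiv ℝ (fun y : X => y) = fun _ => ContinuousLinearMap.id ℝ X :=
      funext fun x => fderiv_fun_id
    refine ⟨‖ContinuousLinearMap.id ℝ X‖, norm_nonneg _, fun x _ => ?_⟩
    rw [← norm_iteratedFDeriv_fderiv, h]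
    rcases k with _ | k
    · rw [norm_iteratedFDeriv_zero]
    · rw [iteratedFDeriv_const_of_ne (by simp)]
      simp

/-- Leibniz for the bilinear B bounds every derivative by those of the identity, which are bounded
on balls. -/
theorem uniformlySmooth_diagonal {X Y : Type*} [NormedAddCommGroup X] [NormedSpace ℝ X]
    [NormedAddCommGroup Y] [NormedSpace ℝ Y] (B : X →L[ℝ] X →L[ℝ] Y) :
    UniformlySmooth fun u => B u u := by
  refine ⟨B.contDiff.clm_apply contDiff_id, fun k R => ?_⟩
  -- The radius max R 0 provides the nonnegativity needed when R is negative.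
  choose C hC hb using fun i => exists_norm_iteratedFDeriv_id_le (X := X) i (le_max_right R 0)
  refine ⟨‖B‖ * ∑ i ∈ Finset.range (k + 1), (k.choose i : ℝ) * C i * C (k - i), fun x hx => ?_⟩
  have hx' := hx.trans (le_max_left R 0)
  refine (B.norm_iteratedFDeriv_le_of_bilinear (N := ∞) (f := fun y : X => y)
    (g := fun y : X => y) contDiff_id contDiff_id x (by exact_mod_cast le_top)).trans ?_
  gcongr with i _
  · exact mul_nonneg (by positivity) (hC i)
  · exact hb i x hx'
  · exact hb (k - i) x hx'

end GalNS

end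

theorem proposition4p6 (φ : GalNS.LittlewoodPaley) (α β κ : ℝ)
    (hα : 0 < α) (hβ : α / 2 < β) (hκ : 0 < κ) :
    (∃ C : NNReal, ∀ u : GalNS.VField, GalNS.IsSolenoidal u → φ.besovENorm β u < ⊤ →
      GalNS.TensorDefined u u ∧ GalNS.TensorDefined u (GalNS.fracGrad α u) ∧
      φ.besovENorm (min β (2 * β - 1) - κ) (GalNS.galG α u) ≤ C * φ.besovENorm β u ^ 2) ∧
    ∃ F : φ.HolderBesov β → φ.HolderBesov (min β (2 * β - 1) - κ),
      (∀ u : φ.HolderBesov β, (F u).toField = GalNS.galG α u.toField) ∧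
      GalNS.UniformlySmooth F := by
  constructor
  · obtain ⟨C, hC, hb⟩ := φ.exists_galB_bound hα hβ hκ
    refine ⟨C.toNNReal, fun u hu hfin => ?_⟩
    have hbd := φ.hasBound_of_besovENorm hu.meanFree hfin
    have hconv := hbd.convSummable hα hβ hbd
    -- `galG α u` unfolds to `galB α u u`, so the bilinear bound applies directly.
    refine ⟨hconv.tensorDefined, hconv.tensorDefined_fracGrad,
      (hb u u _ _ hu.divFree hbd hbd).trans (le_of_eq ?_)⟩
    rw [ENNReal.ofReal_mul hC, ENNReal.ofReal_mul ENNReal.toReal_nonneg,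
      ENNReal.ofReal_toReal hfin.ne, sq]
    rfl
  · obtain ⟨B, hB⟩ := GalNS.exists_bilinear_galB φ hα hβ hκ
    exact ⟨fun u => B u u, fun u => hB u u, GalNS.uniformlySmooth_diagonal B⟩
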